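/- Manifolds are smooth, Hausdorff and modelled on real Banach spaces (finite-dimensional ones included), with no countability assumption. Let $M$ be a manifold. A *bundle gerbe* $(P,X)$ on $M$ consists of a smooth surjection $\pi\colon X\to M$ from a manifold $X$ admitting local smooth sections, a smooth principal $\mathbb C^\times$-bundle $P$ on $X^{[2]}=X\times_MX$, and a product, i.e. an isomorphism $\pi_1^{-1}P\otimes\pi_3^{-1}P\to\pi_2^{-1}P$ of $\mathbb C^\times$-bundles on $X^{[3]}$ ($\pi_i$ omits the $i$-th factor, $\otimes$ is the contracted product), fibrewise $P_{(x_2,x_3)}\otimes P_{(x_1,x_2)}\to P_{(x_1,x_3)}$, $u_{23}\otimes u_{12}\mapsto u_{23}u_{12}$, which is associative. (Smooth functions on $X^{[2]}$ and $X^{[3]}$ are those that locally extend to smooth functions on $X\times X$ and $X\times X\times X$.) It has an identity section $e(x)\in P_{(x,x)}$ and inverses $u\mapsto u^{-1}$, $P_{(x_1,x_2)}\to P_{(x_2,x_1)}$. A *morphism* $f=(\hat f,f)\colon(P,X)\to(Q,Y)$ is a smooth map $f\colon X\to Y$ over $M$ together with a morphism $\hat f\colon P\to Q$ of $\mathbb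 C^\times$-bundles covering $f^{[2]}\colon X^{[2]}\to Y^{[2]}$ and preserving the products. For morphisms $f,g\colon P\to Q$ put $\hat D_{f,g}=(f,g)^{-1}Q$, a $\mathbb C^\times$-bundle on $X$ with fibres $Q_{(f(x),g(x))}$. Then the following hold. 1. For $v\in(\hat D_{f,g})_{x_1}$ and $u\in P_{(x_1,x_2)}$, the element $\phi_{f,g}(v)=\hat g(u)\,(v\,\hat f(u^{-1}))$ does not depend on $u$, and this defines a smooth descent isomorphism $\phi_{f,g}\colon\pi_2^{-1}\hat D_{f,g}\to\pi_1^{-1}\hat D_{f,g}$ over $X^{[2]}$ (it satisfies the cocycle condition over $X^{[3]}$). Hence $\hat D_{f,g}$ descends to $M$: there are a $\mathbb C^\times$-bundle $D_{f,g}$ on $M$ and an isomorphism $\psi_{f,g}\colon\hat D_{f,g}\to\pi^{-1}D_{f,g}$ compatible with $\phi_{f,g}$. 2. Choose such $(D_{f,g},\psi_{f,g})$ for all $f,g$ in any way. A *transformation* $\theta\colon f\Rightarrow g$ is a smooth global section of $D_{f,g}$; let $\hat\theta$ be its lift to a section of $\hat D_{f,g}$, so $\psi_{f,g}(\hat\theta(x))=\theta(\pi(x))$.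 Then: - the product of $Q$ induces isomorphisms $D_{g,h}\otimes D_{f,g}\to D_{f,h}$ of $\mathbb C^\times$-bundles on $M$, $\psi_{g,h}(v)\otimes\psi_{f,g}(u)\mapsto\psi_{f,h}(vu)$, and the vertical composite $\lambda\theta\colon f\Rightarrow h$ of $\theta\colon f\Rightarrow g$ and $\lambda\colon g\Rightarrow h$ is defined as the image of the section $\lambda\otimes\theta$; - there is a transformation $1_f\colon f\Rightarrow f$ with lift $x\mapsto e(f(x))$; - for $f_1,f_2\colon P\to Q$, $g_1,g_2\colon Q\to R$, $\theta\colon f_1\Rightarrow f_2$ and $\lambda\colon g_1\Rightarrow g_2$, there is a transformation $\lambda\circ\theta\colon g_1\circ f_1\Rightarrow g_2\circ f_2$ (the horizontal composite) with lift $x\mapsto\hat g_2(\hat\theta(x))\,\hat\lambda(f_1(x))$; - the interchange law $(\lambda_{23}\lambda_{12})\circ(\theta_{23}\theta_{12})=(\lambda_{23}\circ\theta_{23})(\lambda_{12}\circ\theta_{12})$ holds; - with these data there is a (strict) $2$-category $\mathbf{BGrb}_M$ whose objects are the bundle gerbes on $M$, whose $1$-arrows are the bundle gerbe morphisms with their usual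 composition, and whose $2$-arrows are the transformations, with the vertical and horizontal compositions and identities above. -/

import Mathlib

open CategoryTheory
open scoped Manifold ContDiff Topology

universe u v w

/-! ## Principal `ℂˣ`-bundles over manifolds and over subspaces of manifolds

Bundles are needed over manifolds `M`, `X` and over the fibre products `X^[2] ⊆ X × X` and
`X^[3] ⊆ X × X × X`.  All of these are treated at once: a base is a space `B` with an inclusion
`ι : B → N` into a manifold `N` (with `ι = id` when `B` is itself the manifold), and smooth functions
on `B` are those which locally are restrictions of smooth functions on `N`. For an embedded
submanifold (such as `X^[2]` when `X → M` is a submersion) these are the usual smooth functions. -/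

section Bundles

/-- `f : B → ℂ` is smooth on `U ⊆ B`: near each point of `U` it is the restriction, along the
inclusion `ι` of `B` in the manifold `N`, of a smooth function on an open subset of `N`. -/
def SmoothFunOn {E : Type*} [NormedAddCommGroup E] [NormedSpace ℝ E]
    {H : Type*} [TopologicalSpace H] (I : ModelWithCorners ℝ E H)
    {N : Type*} [TopologicalSpace N] [ChartedSpace H N]
    {B : Type*} [TopologicalSpace B] (ι : B → N) (U : Set B) (f : B → ℂ) : Prop :=
  ∀ b ∈ U, ∃ V : Set N, IsOpen V ∧ ι b ∈ V ∧ ∃ F : N → ℂ,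
    ContMDiffOn I 𝓘(ℝ, ℂ) ∞ F V ∧ ∀ᶠ b' in 𝓝[U] b, f b' = F (ι b')

/-- A map between bases `ι' : B' → N'` and `ι : B → N` that is the restriction of a smooth map
between the ambient manifolds. -/
structure BaseMap {E' : Type*} [NormedAddCommGroup E'] [NormedSpace ℝ E']
    {H' : Type*} [TopologicalSpace H'] (I' : ModelWithCorners ℝ E' H')
    {N' : Type*} [TopologicalSpace N'] [ChartedSpace H' N']
    {B' : Type*} [TopologicalSpace B'] (ι' : B' → N')
    {E : Type*} [NormedAddCommGroup E] [NormedSpace ℝ E]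
    {H : Type*} [TopologicalSpace H] (I : ModelWithCorners ℝ E H)
    {N : Type*} [TopologicalSpace N] [ChartedSpace H N]
    {B : Type*} [TopologicalSpace B] (ι : B → N) where
  toFun : B' → B
  ambient : N' → N
  continuous_toFun : Continuous toFun
  smooth_ambient : ContMDiff I' I ∞ ambient
  comm : ∀ b, ι (toFun b) = ambient (ι' b)

variable {E : Type*} [NormedAddCommGroup E] [NormedSpace ℝ E]
  {H : Type*} [TopologicalSpace H] {I : ModelWithCorners ℝ E H}
  {N : Type*} [TopologicalSpace N] [ChartedSpace H N]
  {B : Type*} [TopologicalSpace B] {ι : B → N}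
  {E' : Type*} [NormedAddCommGroup E'] [NormedSpace ℝ E']
  {H' : Type*} [TopologicalSpace H'] {I' : ModelWithCorners ℝ E' H'}
  {N' : Type*} [TopologicalSpace N'] [ChartedSpace H' N']
  {B' : Type*} [TopologicalSpace B'] {ι' : B' → N'}

/-- A smooth principal `ℂˣ`-bundle on `B`: a family of `ℂˣ`-torsors with an atlas of local
trivialisations, given by local sections `σ = (U, s)` over open sets `U` whose transition functions
`s' = g • s` are smooth maps to `ℂˣ`.  (All fibres are nonempty, so a local section is recorded as a
globally defined function with irrelevant values outside `U`.) -/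
structure CxBundle (I : ModelWithCorners ℝ E H) (ι : B → N) where
  fiber : B → Type v
  [action : ∀ b, MulAction ℂˣ (fiber b)]
  torsor : ∀ b (p q : fiber b), ∃! z : ℂˣ, q = z • p
  atlas : Set (Set B × (∀ b, fiber b))
  isOpen_atlas : ∀ σ ∈ atlas, IsOpen σ.1
  cover : ∀ b, ∃ σ ∈ atlas, b ∈ σ.1
  transition : ∀ σ ∈ atlas, ∀ τ ∈ atlas, ∃ g : B → ℂˣ, (∀ b, τ.2 b = g b • σ.2 b) ∧
    SmoothFunOn I ι (τ.1 ∩ σ.1) (fun b => (g b : ℂ))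

attribute [instance] CxBundle.action

namespace CxBundle

/-- The section `s` is smooth over `U`: in each local trivialisation it is a smooth function. -/
def IsSmoothOn (L : CxBundle I ι) (U : Set B) (s : ∀ b, L.fiber b) : Prop :=
  ∀ σ ∈ L.atlas, ∃ g : B → ℂˣ, (∀ b, s b = g b • σ.2 b) ∧
    SmoothFunOn I ι (U ∩ σ.1) (fun b => (g b : ℂ))

/-- Global smooth sections. -/
def GlobalSection (L : CxBundle I ι) : Type _ :=
  {s : ∀ b, L.fiber b // L.IsSmoothOn Set.univ s}

/-- Morphisms of `ℂˣ`-bundles covering the identity: smooth `ℂˣ`-equivariant maps. (Each of them is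
an isomorphism, as for all principal bundles.) -/
@[ext] structure Hom (L : CxBundle.{v} I ι) (K : CxBundle.{w} I ι) where
  toFun : ∀ b, L.fiber b → K.fiber b
  equivariant : ∀ b (z : ℂˣ) (p : L.fiber b), toFun b (z • p) = z • toFun b p
  smooth : ∀ (U : Set B) (s : ∀ b, L.fiber b), IsOpen U → L.IsSmoothOn U s →
    K.IsSmoothOn U (fun b => toFun b (s b))

/-- The pullback `h⁻¹L`. -/
def pullback (L : CxBundle.{v} I ι) (h : BaseMap I' ι' I ι) : CxBundle.{v} I' ι' where
  fiber b := L.fiber (h.toFun b)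
  torsor b := L.torsor (h.toFun b)
  atlas := {σ' | ∃ σ ∈ L.atlas, σ' = (h.toFun ⁻¹' σ.1, fun b => σ.2 (h.toFun b))}
  isOpen_atlas := by
    rintro _ ⟨σ, hσ, rfl⟩
    exact (L.isOpen_atlas σ hσ).preimage h.continuous_toFun
  cover b := by
    obtain ⟨σ, hσ, hb⟩ := L.cover (h.toFun b)
    exact ⟨_, ⟨σ, hσ, rfl⟩, hb⟩
  transition := by
    rintro _ ⟨σ, hσ, rfl⟩ _ ⟨τ, hτ, rfl⟩
    obtain ⟨g, hg, hs⟩ := L.transition σ hσ τ hτ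
    refine ⟨fun b => g (h.toFun b), fun b => hg _, fun b hb => ?_⟩
    obtain ⟨V, hV, hbV, F, hF, hFe⟩ := hs (h.toFun b) hb
    refine ⟨h.ambient ⁻¹' V, hV.preimage h.smooth_ambient.continuous, ?_, F ∘ h.ambient,
      hF.comp h.smooth_ambient.contMDiffOn (fun _ hx => hx), ?_⟩
    · simpa [← h.comm b] using hbV
    · have ht : Filter.Tendsto h.toFun (𝓝[h.toFun ⁻¹' τ.1 ∩ h.toFun ⁻¹' σ.1] b)
          (𝓝[τ.1 ∩ σ.1] (h.toFun b)) :=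
        h.continuous_toFun.continuousWithinAt.tendsto_nhdsWithin (fun _ hx => hx)
      filter_upwards [ht.eventually hFe] with b' hb'
      rw [Function.comp_apply, ← h.comm b']
      exact hb'

/-- The equivalence relation `(z p, q) ∼ (p, z q)` defining the contracted product. -/
def tensorSetoid (L : CxBundle.{v} I ι) (K : CxBundle.{w} I ι) (b : B) :
    Setoid (L.fiber b × K.fiber b) where
  r x y := ∃ z : ℂˣ, y.1 = z • x.1 ∧ x.2 = z • y.2
  iseqv :=
    { refl := fun x => ⟨1, by simp⟩
      symm := by
        rintro x y ⟨z, h₁, h₂⟩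
        exact ⟨z⁻¹, by simp [h₁], by simp [h₂]⟩
      trans := by
        rintro x y t ⟨z, h₁, h₂⟩ ⟨z', h₁', h₂'⟩
        exact ⟨z' * z, by rw [h₁', h₁, mul_smul], by rw [h₂, h₂', mul_comm, mul_smul]⟩ }

/-- The fibre of the contracted product. -/
def TensorFiber (L : CxBundle.{v} I ι) (K : CxBundle.{w} I ι) (b : B) : Type (max v w) :=
  Quotient (tensorSetoid L K b)

/-- The element `p ⊗ q` of the contracted product. -/
def tmul {L : CxBundle.{v} I ι} {K : CxBundle.{w} I ι} {b : B} (p : L.fiber b) (q : K.fiber b) :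
    TensorFiber L K b :=
  Quotient.mk (tensorSetoid L K b) (p, q)

instance (L : CxBundle.{v} I ι) (K : CxBundle.{w} I ι) (b : B) :
    MulAction ℂˣ (TensorFiber L K b) where
  smul z := Quotient.map (fun x => (z • x.1, x.2)) (by
    rintro x y ⟨a, h₁, h₂⟩
    exact ⟨a, by simp only [h₁, smul_smul, mul_comm], h₂⟩)
  one_smul := by
    rintro ⟨p, q⟩
    exact congrArg (Quotient.mk _) (by simp)
  mul_smul := by
    rintro z z' ⟨p, q⟩
    exact congrArg (Quotient.mk _) (by simp [mul_smul])

theorem smul_tmul {L : CxBundle.{v} I ι} {K : CxBundle.{w} I ι} {b : B} (z : ℂˣ)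
    (p : L.fiber b) (q : K.fiber b) : z • tmul p q = tmul (z • p) q := rfl

theorem tmul_smul {L : CxBundle.{v} I ι} {K : CxBundle.{w} I ι} {b : B} (z : ℂˣ)
    (p : L.fiber b) (q : K.fiber b) : tmul p (z • q) = z • tmul p q :=
  Quotient.sound (s := tensorSetoid L K b) ⟨z, rfl, rfl⟩

/-- The contracted product `L ⊗ K` of two `ℂˣ`-bundles. -/
def tensor (L : CxBundle.{v} I ι) (K : CxBundle.{w} I ι) : CxBundle.{max v w} I ι where
  fiber := TensorFiber L K
  torsor := by
    rintro b ⟨p, q⟩ ⟨p', q'⟩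
    obtain ⟨a, ha, -⟩ := L.torsor b p p'
    obtain ⟨c, hc, -⟩ := K.torsor b q q'
    refine ⟨c * a, ?_, fun z hz => ?_⟩
    · change tmul p' q' = (c * a) • tmul p q
      rw [ha, hc, tmul_smul, mul_smul, smul_tmul a]
    · obtain ⟨d, h₁, h₂⟩ := Quotient.exact (s := tensorSetoid L K b) hz
      have h₁' : z • p = d • p' := h₁
      have h₂' : q' = d • q := h₂
      have hcd : d = c := (K.torsor b q q').unique h₂' hc
      exact (L.torsor b p (z • p)).unique rfl
        (show z • p = (c * a) • p by rw [h₁', ha, hcd, mul_smul])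
  atlas := {ρ | ∃ σ ∈ L.atlas, ∃ τ ∈ K.atlas, ρ = (σ.1 ∩ τ.1, fun b => tmul (σ.2 b) (τ.2 b))}
  isOpen_atlas := by
    rintro _ ⟨σ, hσ, τ, hτ, rfl⟩
    exact (L.isOpen_atlas σ hσ).inter (K.isOpen_atlas τ hτ)
  cover b := by
    obtain ⟨σ, hσ, hb⟩ := L.cover b
    obtain ⟨τ, hτ, hb'⟩ := K.cover b
    exact ⟨_, ⟨σ, hσ, τ, hτ, rfl⟩, hb, hb'⟩
  transition := by
    rintro _ ⟨σ, hσ, τ, hτ, rfl⟩ _ ⟨σ', hσ', τ', hτ', rfl⟩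
    obtain ⟨g, hg, hs⟩ := L.transition σ hσ σ' hσ'
    obtain ⟨k, hk, ht⟩ := K.transition τ hτ τ' hτ'
    refine ⟨fun b => k b * g b, fun b => ?_, fun b hb => ?_⟩
    · change tmul (σ'.2 b) (τ'.2 b) = (k b * g b) • tmul (σ.2 b) (τ.2 b)
      rw [hg, hk, tmul_smul, mul_smul, smul_tmul (g b)]
    · obtain ⟨V, hV, hbV, F, hF, hFe⟩ := hs b ⟨hb.1.1, hb.2.1⟩
      obtain ⟨W, hW, hbW, G, hG, hGe⟩ := ht b ⟨hb.1.2, hb.2.2⟩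
      refine ⟨V ∩ W, hV.inter hW, ⟨hbV, hbW⟩, fun n => G n * F n,
        (contDiff_mul (𝕜 := ℝ) (𝔸 := ℂ)).contMDiff.comp_contMDiffOn
          ((hG.mono Set.inter_subset_right).prodMk_space (hF.mono Set.inter_subset_left)),
        ?_⟩
      have hFe' := hFe.filter_mono (nhdsWithin_mono b
        (show (σ'.1 ∩ τ'.1) ∩ (σ.1 ∩ τ.1) ⊆ σ'.1 ∩ σ.1 from fun _ hx => ⟨hx.1.1, hx.2.1⟩))
      have hGe' := hGe.filter_mono (nhdsWithin_mono b
        (show (σ'.1 ∩ τ'.1) ∩ (σ.1 ∩ τ.1) ⊆ τ'.1 ∩ τ.1 from fun _ hx => ⟨hx.1.2, hx.2.2⟩))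
      filter_upwards [hFe', hGe'] with b' h1 h2
      rw [Units.val_mul, ← h1, ← h2]

/-- A bundle morphism carries smooth sections along a map `h` to smooth sections along `h`. -/
theorem Hom.smooth_pullback {L : CxBundle.{v} I ι} {K : CxBundle.{w} I ι} (φ : Hom L K)
    (h : BaseMap I' ι' I ι) (U : Set B') (hU : IsOpen U) (t : ∀ b, (L.pullback h).fiber b)
    (ht : (L.pullback h).IsSmoothOn U t) :
    (K.pullback h).IsSmoothOn U (fun b => φ.toFun (h.toFun b) (t b)) := by
  rintro _ ⟨τ, hτ, rfl⟩
  have hex := fun b => (K.torsor (h.toFun b) (τ.2 (h.toFun b)) (φ.toFun (h.toFun b) (t b))).exists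
  choose g hg using hex
  refine ⟨g, hg, fun b hb => ?_⟩
  obtain ⟨σ, hσ, hbσ⟩ := L.cover (h.toFun b)
  obtain ⟨a, ha, has⟩ := ht _ ⟨σ, hσ, rfl⟩
  obtain ⟨k, hk, hks⟩ := φ.smooth σ.1 σ.2 (L.isOpen_atlas σ hσ)
    (fun ρ hρ => L.transition ρ hρ σ hσ) τ hτ
  have hgak : ∀ b', g b' = a b' * k (h.toFun b') := fun b' =>
    (K.torsor (h.toFun b') (τ.2 (h.toFun b')) (φ.toFun (h.toFun b') (t b'))).unique (hg b') (by
      have h1 : t b' = a b' • (σ.2 (h.toFun b') : L.fiber (h.toFun b')) := ha b'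
      change φ.toFun (h.toFun b') (t b') = (a b' * k (h.toFun b')) • τ.2 (h.toFun b')
      rw [h1, φ.equivariant, show φ.toFun _ (σ.2 (h.toFun b')) = _ from hk (h.toFun b'),
        mul_smul])
  obtain ⟨V, hV, hbV, F, hF, hFe⟩ := has b ⟨hb.1, hbσ⟩
  obtain ⟨W, hW, hbW, G, hG, hGe⟩ := hks (h.toFun b) ⟨hbσ, hb.2⟩
  have hσn : h.toFun ⁻¹' σ.1 ∈ 𝓝 b :=
    ((L.isOpen_atlas σ hσ).preimage h.continuous_toFun).mem_nhds hbσ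
  have hτn : h.toFun ⁻¹' τ.1 ∈ 𝓝 b :=
    ((K.isOpen_atlas τ hτ).preimage h.continuous_toFun).mem_nhds hb.2
  have hFe' : ∀ᶠ b' in 𝓝 b, ((a b' : ℂˣ) : ℂ) = F (ι' b') := by
    rwa [nhdsWithin_eq_nhds.2 (Filter.inter_mem (hU.mem_nhds hb.1) hσn)] at hFe
  have hGe' : ∀ᶠ b' in 𝓝 b, ((k (h.toFun b') : ℂˣ) : ℂ) = G (ι (h.toFun b')) := by
    rw [nhdsWithin_eq_nhds.2 (Filter.inter_mem ((L.isOpen_atlas σ hσ).mem_nhds hbσ)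
      ((K.isOpen_atlas τ hτ).mem_nhds hb.2))] at hGe
    exact h.continuous_toFun.continuousAt.eventually hGe
  refine ⟨V ∩ h.ambient ⁻¹' W, hV.inter (hW.preimage h.smooth_ambient.continuous),
    ⟨hbV, by simpa [← h.comm b] using hbW⟩, fun n => F n * G (h.ambient n),
    (contDiff_mul (𝕜 := ℝ) (𝔸 := ℂ)).contMDiff.comp_contMDiffOn
      ((hF.mono Set.inter_subset_left).prodMk_space
        (hG.comp h.smooth_ambient.contMDiffOn (fun _ hx => hx.2))), ?_⟩
  filter_upwards [nhdsWithin_le_nhds hFe', nhdsWithin_le_nhds hGe'] with b' h1 h2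
  rw [hgak, Units.val_mul, h1, h2, h.comm]

end CxBundle

end Bundles

/-! ## Fibre products and descent -/

section FibreProducts

variable {EM : Type*} [NormedAddCommGroup EM] [NormedSpace ℝ EM]
  {M : Type*} [TopologicalSpace M] [ChartedSpace EM M]
  {E : Type*} [NormedAddCommGroup E] [NormedSpace ℝ E]
  {X : Type*} [TopologicalSpace X] [ChartedSpace E X]
  {F : Type*} [NormedAddCommGroup F] [NormedSpace ℝ F]
  {Y : Type*} [TopologicalSpace Y] [ChartedSpace F Y]

/-- The fibre product `X^[2] = X ×_M X`. -/
abbrev FibSq (π : X → M) : Type _ := {p : X × X // π p.1 = π p.2}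

/-- The triple fibre product `X^[3]`. -/
abbrev FibCube (π : X → M) : Type _ := {p : X × X × X // π p.1 = π p.2.1 ∧ π p.2.1 = π p.2.2}

/-- The inclusion `X^[2] ⊆ X × X`. -/
abbrev FibSq.incl (π : X → M) : FibSq π → X × X := Subtype.val

/-- The inclusion `X^[3] ⊆ X × X × X`. -/
abbrev FibCube.incl (π : X → M) : FibCube π → X × X × X := Subtype.val

/-- The point `(x₁, x₂)` of `X^[2]`. -/
abbrev FibSq.mk {π : X → M} {x₁ x₂ : X} (h : π x₁ = π x₂) : FibSq π := ⟨(x₁, x₂), h⟩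

/-- The point `(x₁, x₂, x₃)` of `X^[3]`. -/
abbrev FibCube.mk {π : X → M} {x₁ x₂ x₃ : X} (h₁₂ : π x₁ = π x₂) (h₂₃ : π x₂ = π x₃) :
    FibCube π := ⟨(x₁, x₂, x₃), h₁₂, h₂₃⟩

/-- A smooth map of manifolds as a map of bases. -/
def BaseMap.ofContMDiff (f : X → Y) (hf : ContMDiff 𝓘(ℝ, E) 𝓘(ℝ, F) ∞ f) :
    BaseMap 𝓘(ℝ, E) (id : X → X) 𝓘(ℝ, F) (id : Y → Y) :=
  ⟨f, f, hf.continuous, hf, fun _ => rfl⟩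

/-- `π₁ : X^[2] → X`, omitting the first factor. -/
def FibSq.π₁ (π : X → M) :
    BaseMap (𝓘(ℝ, E).prod 𝓘(ℝ, E)) (FibSq.incl π) 𝓘(ℝ, E) (id : X → X) :=
  ⟨fun p => p.1.2, Prod.snd, by fun_prop, contMDiff_snd, fun _ => rfl⟩

/-- `π₂ : X^[2] → X`, omitting the second factor. -/
def FibSq.π₂ (π : X → M) :
    BaseMap (𝓘(ℝ, E).prod 𝓘(ℝ, E)) (FibSq.incl π) 𝓘(ℝ, E) (id : X → X) :=
  ⟨fun p => p.1.1, Prod.fst, by fun_prop, contMDiff_fst, fun _ => rfl⟩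

/-- `π₁ : X^[3] → X^[2]`, omitting the first factor. -/
def FibCube.π₁ (π : X → M) :
    BaseMap (𝓘(ℝ, E).prod (𝓘(ℝ, E).prod 𝓘(ℝ, E))) (FibCube.incl π)
      (𝓘(ℝ, E).prod 𝓘(ℝ, E)) (FibSq.incl π) :=
  ⟨fun p => FibSq.mk p.2.2, fun p => p.2, by fun_prop, contMDiff_snd, fun _ => rfl⟩

/-- `π₂ : X^[3] → X^[2]`, omitting the second factor. -/
def FibCube.π₂ (π : X → M) :
    BaseMap (𝓘(ℝ, E).prod (𝓘(ℝ, E).prod 𝓘(ℝ, E))) (FibCube.incl π)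
      (𝓘(ℝ, E).prod 𝓘(ℝ, E)) (FibSq.incl π) :=
  ⟨fun p => FibSq.mk (p.2.1.trans p.2.2), fun p => (p.1, p.2.2), by fun_prop,
    contMDiff_fst.prodMk (contMDiff_snd.comp contMDiff_snd), fun _ => rfl⟩

/-- `π₃ : X^[3] → X^[2]`, omitting the third factor. -/
def FibCube.π₃ (π : X → M) :
    BaseMap (𝓘(ℝ, E).prod (𝓘(ℝ, E).prod 𝓘(ℝ, E))) (FibCube.incl π)
      (𝓘(ℝ, E).prod 𝓘(ℝ, E)) (FibSq.incl π) :=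
  ⟨fun p => FibSq.mk p.2.1, fun p => (p.1, p.2.1), by fun_prop,
    contMDiff_fst.prodMk (contMDiff_fst.comp contMDiff_snd), fun _ => rfl⟩

/-- `f^[2] : X^[2] → Y^[2]` for a smooth map `f : X → Y` over `M`. -/
def FibSq.map {πX : X → M} {πY : Y → M} (f : X → Y) (hf : ContMDiff 𝓘(ℝ, E) 𝓘(ℝ, F) ∞ f)
    (hc : ∀ x, πY (f x) = πX x) :
    BaseMap (𝓘(ℝ, E).prod 𝓘(ℝ, E)) (FibSq.incl πX) (𝓘(ℝ, F).prod 𝓘(ℝ, F)) (FibSq.incl πY) :=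
  ⟨fun p => FibSq.mk (x₁ := f p.1.1) (x₂ := f p.1.2) (by rw [hc, hc, p.2]),
    fun p => (f p.1, f p.2), by have := hf.continuous; fun_prop,
    (hf.comp contMDiff_fst).prodMk (hf.comp contMDiff_snd), fun _ => rfl⟩

/-- `(f, g) : X → Y^[2]` for smooth maps `f, g : X → Y` over `M`. -/
def FibSq.lift {πX : X → M} {πY : Y → M} (f g : X → Y)
    (hf : ContMDiff 𝓘(ℝ, E) 𝓘(ℝ, F) ∞ f) (hg : ContMDiff 𝓘(ℝ, E) 𝓘(ℝ, F) ∞ g)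
    (hcf : ∀ x, πY (f x) = πX x) (hcg : ∀ x, πY (g x) = πX x) :
    BaseMap 𝓘(ℝ, E) (id : X → X) (𝓘(ℝ, F).prod 𝓘(ℝ, F)) (FibSq.incl πY) :=
  ⟨fun x => FibSq.mk (x₁ := f x) (x₂ := g x) (by rw [hcf, hcg]),
    fun x => (f x, g x), by have := hf.continuous; have := hg.continuous; fun_prop,
    hf.prodMk hg, fun _ => rfl⟩

/-- A descent isomorphism for a `ℂˣ`-bundle `L` on `X` along `π : X → M`: an isomorphism
`φ : π₂⁻¹L → π₁⁻¹L` over `X^[2]`, fibrewise `L_{x₁} → L_{x₂}`, satisfying the cocycle condition. -/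
structure DescentIso (π : X → M) (L : CxBundle.{v} 𝓘(ℝ, E) (id : X → X)) where
  φ : CxBundle.Hom (L.pullback (FibSq.π₂ π)) (L.pullback (FibSq.π₁ π))
  cocycle : ∀ {x₁ x₂ x₃ : X} (h₁₂ : π x₁ = π x₂) (h₂₃ : π x₂ = π x₃) (v : L.fiber x₁),
    φ.toFun (FibSq.mk h₂₃) (φ.toFun (FibSq.mk h₁₂) v) = φ.toFun (FibSq.mk (h₁₂.trans h₂₃)) v

/-- A descent of `(L, φ)` to `M`: a `ℂˣ`-bundle `D` on `M` with an isomorphism `ψ : L → π⁻¹D`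
compatible with `φ`, i.e. `ψ (φ v) = ψ v` in the total space of `D`. -/
structure Descended {π : X → M} (hπ : ContMDiff 𝓘(ℝ, E) 𝓘(ℝ, EM) ∞ π)
    {L : CxBundle.{v} 𝓘(ℝ, E) (id : X → X)} (d : DescentIso π L) where
  bundle : CxBundle.{v} 𝓘(ℝ, EM) (id : M → M)
  ψ : CxBundle.Hom L (bundle.pullback (BaseMap.ofContMDiff π hπ))
  compat : ∀ {x₁ x₂ : X} (h : π x₁ = π x₂) (v : L.fiber x₁),
    (⟨π x₂, ψ.toFun x₂ (d.φ.toFun (FibSq.mk h) v)⟩ : Σ m, bundle.fiber m) = ⟨π x₁, ψ.toFun x₁ v⟩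

theorem CxBundle.Hom.exists_preimage {H : Type*} [TopologicalSpace H] {I : ModelWithCorners ℝ E H}
    {N : Type*} [TopologicalSpace N] [ChartedSpace H N] {B : Type*} [TopologicalSpace B] {ι : B → N}
    {L : CxBundle.{v} I ι} {K : CxBundle.{w} I ι} (φ : CxBundle.Hom L K) (b : B) (q : K.fiber b) :
    ∃ p, φ.toFun b p = q := by
  obtain ⟨σ, -, -⟩ := L.cover b
  obtain ⟨z, hz, -⟩ := K.torsor b (φ.toFun b (σ.2 b)) q
  exact ⟨z • σ.2 b, by rw [φ.equivariant, hz]⟩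

/-- The lift `θ̂` to `X` of a section `θ` of the descended bundle: `ψ (θ̂ x) = θ (π x)`. -/
noncomputable def Descended.lift {π : X → M} {hπ : ContMDiff 𝓘(ℝ, E) 𝓘(ℝ, EM) ∞ π}
    {L : CxBundle.{v} 𝓘(ℝ, E) (id : X → X)} {d : DescentIso π L} (D : Descended hπ d)
    (θ : D.bundle.GlobalSection) (x : X) : L.fiber x :=
  (D.ψ.exists_preimage x (θ.1 (π x))).choose

end FibreProducts

/-! ## Bundle gerbes and their morphisms -/

section Gerbes

/-- The product `u₂₃ u₁₂ = m (u₂₃ ⊗ u₁₂)` given by a map `m : π₁⁻¹P ⊗ π₃⁻¹P → π₂⁻¹P`. -/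
noncomputable def gerbeProduct {M : Type*}
    {E : Type*} [NormedAddCommGroup E] [NormedSpace ℝ E]
    {X : Type*} [TopologicalSpace X] [ChartedSpace E X] {π : X → M}
    {P : CxBundle.{v} (𝓘(ℝ, E).prod 𝓘(ℝ, E)) (FibSq.incl π)}
    (m : CxBundle.Hom ((P.pullback (FibCube.π₁ π)).tensor (P.pullback (FibCube.π₃ π)))
      (P.pullback (FibCube.π₂ π)))
    {x₁ x₂ x₃ : X} {h₁₂ : π x₁ = π x₂} {h₂₃ : π x₂ = π x₃}
    (u₂₃ : P.fiber (FibSq.mk h₂₃)) (u₁₂ : P.fiber (FibSq.mk h₁₂)) :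
    P.fiber (FibSq.mk (h₁₂.trans h₂₃)) :=
  m.toFun (FibCube.mk h₁₂ h₂₃) (CxBundle.tmul (L := P.pullback (FibCube.π₁ π))
    (K := P.pullback (FibCube.π₃ π)) (b := FibCube.mk h₁₂ h₂₃) u₂₃ u₁₂)

/-- A bundle gerbe `(P, X)` on `M`: a smooth surjection `π : X → M` admitting local sections and
a `ℂˣ`-bundle `P` on `X^[2]` with an associative product. -/
structure BundleGerbe (EM : Type*) [NormedAddCommGroup EM] [NormedSpace ℝ EM]
    (M : Type*) [TopologicalSpace M] [ChartedSpace EM M] where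
  E : Type u
  [normedAddCommGroup : NormedAddCommGroup E]
  [normedSpace : NormedSpace ℝ E]
  [completeSpace : CompleteSpace E]
  X : Type u
  [topologicalSpace : TopologicalSpace X]
  [t2Space : T2Space X]
  [chartedSpace : ChartedSpace E X]
  [isManifold : IsManifold 𝓘(ℝ, E) ∞ X]
  π : X → M
  contMDiff_π : ContMDiff 𝓘(ℝ, E) 𝓘(ℝ, EM) ∞ π
  surjective_π : Function.Surjective π
  local_sections : ∀ m : M, ∃ U : Set M, IsOpen U ∧ m ∈ U ∧ ∃ s : M → X,
    ContMDiffOn 𝓘(ℝ, EM) 𝓘(ℝ, E) ∞ s U ∧ ∀ m' ∈ U, π (s m') = m'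
  bundle : CxBundle.{u} (𝓘(ℝ, E).prod 𝓘(ℝ, E)) (FibSq.incl π)
  prod : CxBundle.Hom
    ((bundle.pullback (FibCube.π₁ π)).tensor (bundle.pullback (FibCube.π₃ π)))
    (bundle.pullback (FibCube.π₂ π))
  assoc : ∀ {x₁ x₂ x₃ x₄ : X} (h₁₂ : π x₁ = π x₂) (h₂₃ : π x₂ = π x₃) (h₃₄ : π x₃ = π x₄)
    (u₃₄ : bundle.fiber (FibSq.mk h₃₄)) (u₂₃ : bundle.fiber (FibSq.mk h₂₃))
    (u₁₂ : bundle.fiber (FibSq.mk h₁₂)),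
    gerbeProduct prod u₃₄ (gerbeProduct prod u₂₃ u₁₂) =
      gerbeProduct prod (gerbeProduct prod u₃₄ u₂₃) u₁₂

namespace BundleGerbe

attribute [instance] normedAddCommGroup normedSpace completeSpace topologicalSpace t2Space
  chartedSpace isManifold

variable {EM : Type*} [NormedAddCommGroup EM] [NormedSpace ℝ EM]
  {M : Type*} [TopologicalSpace M] [ChartedSpace EM M]

/-- The fibre `P_{(x₁, x₂)}`. -/
abbrev Fib (P : BundleGerbe.{u} EM M) {x₁ x₂ : P.X} (h : P.π x₁ = P.π x₂) : Type u :=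
  P.bundle.fiber (FibSq.mk h)

/-- The product `u₂₃ u₁₂` of a bundle gerbe. -/
noncomputable def mul (P : BundleGerbe.{u} EM M) {x₁ x₂ x₃ : P.X} {h₁₂ : P.π x₁ = P.π x₂}
    {h₂₃ : P.π x₂ = P.π x₃} (u₂₃ : P.Fib h₂₃) (u₁₂ : P.Fib h₁₂) : P.Fib (h₁₂.trans h₂₃) :=
  gerbeProduct P.prod u₂₃ u₁₂

theorem smul_mul (P : BundleGerbe.{u} EM M) {x₁ x₂ x₃ : P.X} {h₁₂ : P.π x₁ = P.π x₂}
    {h₂₃ : P.π x₂ = P.π x₃} (z : ℂˣ) (u₂₃ : P.Fib h₂₃) (u₁₂ : P.Fib h₁₂) :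
    P.mul (z • u₂₃) u₁₂ = z • P.mul u₂₃ u₁₂ :=
  P.prod.equivariant (FibCube.mk h₁₂ h₂₃) z (CxBundle.tmul (L := P.bundle.pullback (FibCube.π₁ P.π))
    (K := P.bundle.pullback (FibCube.π₃ P.π)) (b := FibCube.mk h₁₂ h₂₃) u₂₃ u₁₂)

theorem mul_smul (P : BundleGerbe.{u} EM M) {x₁ x₂ x₃ : P.X} {h₁₂ : P.π x₁ = P.π x₂}
    {h₂₃ : P.π x₂ = P.π x₃} (z : ℂˣ) (u₂₃ : P.Fib h₂₃) (u₁₂ : P.Fib h₁₂) :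
    P.mul u₂₃ (z • u₁₂) = z • P.mul u₂₃ u₁₂ :=
  (congrArg (P.prod.toFun (FibCube.mk h₁₂ h₂₃))
    (CxBundle.tmul_smul (L := P.bundle.pullback (FibCube.π₁ P.π))
      (K := P.bundle.pullback (FibCube.π₃ P.π)) (b := FibCube.mk h₁₂ h₂₃) z u₂₃ u₁₂)).trans
    (P.prod.equivariant (FibCube.mk h₁₂ h₂₃) z _)

theorem nonempty_fib (P : BundleGerbe.{u} EM M) {x₁ x₂ : P.X} (h : P.π x₁ = P.π x₂) :
    Nonempty (P.Fib h) := by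
  obtain ⟨σ, -, -⟩ := P.bundle.cover (FibSq.mk h)
  exact ⟨σ.2 _⟩

theorem eq_of_smul_eq (P : BundleGerbe.{u} EM M) {x₁ x₂ : P.X} {h : P.π x₁ = P.π x₂}
    {z : ℂˣ} {p : P.Fib h} (hz : p = z • p) : z = 1 :=
  (P.bundle.torsor _ p p).unique hz (one_smul _ _).symm

theorem exists_one (P : BundleGerbe.{u} EM M) (x : P.X) :
    ∃ e : P.Fib (rfl : P.π x = P.π x),
      (∀ {y : P.X} (h : P.π x = P.π y) (p : P.Fib h), P.mul p e = p) ∧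
      (∀ {y : P.X} (h : P.π y = P.π x) (p : P.Fib h), P.mul e p = p) := by
  obtain ⟨p⟩ := P.nonempty_fib (rfl : P.π x = P.π x)
  obtain ⟨z, hz, -⟩ := P.bundle.torsor _ p (P.mul p p)
  have he : P.mul (z⁻¹ • p) (z⁻¹ • p) = z⁻¹ • p := by
    rw [smul_mul, mul_smul]
    rw [hz, inv_smul_smul]
  refine ⟨z⁻¹ • p, fun {y} h q => ?_, fun {y} h q => ?_⟩
  · obtain ⟨a, ha, -⟩ := P.bundle.torsor _ q (P.mul q (z⁻¹ • p))
    have h1 : P.mul q (z⁻¹ • p) = P.mul (P.mul q (z⁻¹ • p)) (z⁻¹ • p) := by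
      conv_lhs => rw [← he]
      exact P.assoc _ _ _ _ _ _
    have h2 : P.mul (P.mul q (z⁻¹ • p)) (z⁻¹ • p) = a • P.mul q (z⁻¹ • p) := by
      rw [← smul_mul]; exact congrArg (fun t => P.mul t (z⁻¹ • p)) ha
    have h3 : a = 1 := P.eq_of_smul_eq (h1.trans h2)
    exact ha.trans (by rw [h3, one_smul])
  · obtain ⟨a, ha, -⟩ := P.bundle.torsor _ q (P.mul (z⁻¹ • p) q)
    have h1 : P.mul (z⁻¹ • p) q = P.mul (z⁻¹ • p) (P.mul (z⁻¹ • p) q) := by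
      conv_lhs => rw [← he]
      exact (P.assoc _ _ _ _ _ _).symm
    have h2 : P.mul (z⁻¹ • p) (P.mul (z⁻¹ • p) q) = a • P.mul (z⁻¹ • p) q := by
      rw [← mul_smul]; exact congrArg (fun t => P.mul (z⁻¹ • p) t) ha
    have h3 : a = 1 := P.eq_of_smul_eq (h1.trans h2)
    exact ha.trans (by rw [h3, one_smul])

/-- The identity section `e` of a bundle gerbe. -/
noncomputable def one (P : BundleGerbe.{u} EM M) (x : P.X) : P.Fib (rfl : P.π x = P.π x) :=
  (P.exists_one x).choose

theorem exists_inv (P : BundleGerbe.{u} EM M) {x₁ x₂ : P.X} {h : P.π x₁ = P.π x₂}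
    (p : P.Fib h) : ∃ q : P.Fib h.symm, P.mul p q = P.one x₂ := by
  obtain ⟨q⟩ := P.nonempty_fib h.symm
  obtain ⟨z, hz, -⟩ := P.bundle.torsor _ (P.mul p q) (P.one x₂)
  exact ⟨z • q, by rw [mul_smul]; exact hz.symm⟩

/-- The inverse `u⁻¹ ∈ P_{(x₂, x₁)}` of `u ∈ P_{(x₁, x₂)}`. -/
noncomputable def inv (P : BundleGerbe.{u} EM M) {x₁ x₂ : P.X} {h : P.π x₁ = P.π x₂}
    (p : P.Fib h) : P.Fib h.symm :=
  (P.exists_inv p).choose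

/-- A bundle gerbe morphism `(f̂, f) : (P, X) → (Q, Y)` over the identity of `M`: a smooth map
`f : X → Y` over `M` and a `ℂˣ`-bundle morphism `f̂ : P → Q` covering `f^[2]`, i.e. a morphism
`P → (f^[2])⁻¹Q`, which preserves the products. -/
@[ext] structure Mor (P Q : BundleGerbe.{u} EM M) where
  base : P.X → Q.X
  contMDiff_base : ContMDiff 𝓘(ℝ, P.E) 𝓘(ℝ, Q.E) ∞ base
  comm : ∀ x, Q.π (base x) = P.π x
  total : CxBundle.Hom P.bundle (Q.bundle.pullback (FibSq.map base contMDiff_base comm))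
  map_mul : ∀ {x₁ x₂ x₃ : P.X} (h₁₂ : P.π x₁ = P.π x₂) (h₂₃ : P.π x₂ = P.π x₃)
    (u₂₃ : P.Fib h₂₃) (u₁₂ : P.Fib h₁₂),
    total.toFun (FibSq.mk (h₁₂.trans h₂₃)) (P.mul u₂₃ u₁₂) =
      Q.mul (total.toFun (FibSq.mk h₂₃) u₂₃) (total.toFun (FibSq.mk h₁₂) u₁₂)

namespace Mor

variable {P Q R : BundleGerbe.{u} EM M}

theorem pi_eq (f : Mor P Q) {x₁ x₂ : P.X} (h : P.π x₁ = P.π x₂) :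
    Q.π (f.base x₁) = Q.π (f.base x₂) := by
  rw [f.comm, f.comm, h]

theorem pi_eq₂ (f g : Mor P Q) (x : P.X) : Q.π (f.base x) = Q.π (g.base x) := by
  rw [f.comm, g.comm]

/-- The map `f̂ : P_{(x₁, x₂)} → Q_{(f x₁, f x₂)}`. -/
noncomputable def hat (f : Mor P Q) {x₁ x₂ : P.X} {h : P.π x₁ = P.π x₂} (p : P.Fib h) : Q.Fib (f.pi_eq h) :=
  f.total.toFun (FibSq.mk h) p

/-- The identity morphism. -/
noncomputable def id (P : BundleGerbe.{u} EM M) : Mor P P where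
  base := _root_.id
  contMDiff_base := contMDiff_id
  comm _ := rfl
  total :=
    { toFun := fun _ p => p
      equivariant := fun _ _ _ => rfl
      smooth := by
        rintro U s - hs _ ⟨σ, hσ, rfl⟩
        exact hs σ hσ }
  map_mul _ _ _ _ := rfl

/-- The composite `g ∘ f` of bundle gerbe morphisms. -/
noncomputable def comp (g : Mor Q R) (f : Mor P Q) : Mor P R where
  base := g.base ∘ f.base
  contMDiff_base := g.contMDiff_base.comp f.contMDiff_base
  comm x := (g.comm _).trans (f.comm x)
  total :=
    { toFun := fun _ p => g.hat (f.hat p)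
      equivariant := fun b z p =>
        (congrArg (g.total.toFun _) (f.total.equivariant b z p)).trans (g.total.equivariant _ z _)
      smooth := by
        rintro U s hU hs _ ⟨σ, hσ, rfl⟩
        exact g.total.smooth_pullback _ U hU _ (f.total.smooth U s hU hs) _ ⟨_, ⟨σ, hσ, rfl⟩, rfl⟩ }
  map_mul h₁₂ h₂₃ u₂₃ u₁₂ :=
    (congrArg (g.total.toFun _) (f.map_mul h₁₂ h₂₃ u₂₃ u₁₂)).trans (g.map_mul _ _ _ _)

/-- The bundle `D̂_{f,g} = (f, g)⁻¹Q` on `X`, with fibres `Q_{(f x, g x)}`. -/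
noncomputable def Dhat (f g : Mor P Q) : CxBundle.{u} 𝓘(ℝ, P.E) (_root_.id : P.X → P.X) :=
  Q.bundle.pullback
    (FibSq.lift f.base g.base f.contMDiff_base g.contMDiff_base f.comm g.comm)

end Mor

end BundleGerbe

end Gerbes

/-! ## 2-categories -/

/-- The given objects, 1-arrows, 2-arrows, compositions and identities form a (strict) 2-category:
there is a strict bicategory with these objects whose 1-arrows and 2-arrows are identified with the
given ones in such a way that all identities and compositions are the given ones. The 2-arrows are
composed in diagrammatic order: `vcomp θ θ'` is `θ` followed by `θ'`, and `hcomp θ η` is the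
horizontal composite of `θ : f₁ ⇒ f₂` in `Hom(P, Q)` and `η : g₁ ⇒ g₂` in `Hom(Q, R)`. -/
def IsTwoCategory {Ob : Type u} (Hom₁ : Ob → Ob → Type v) (id₁ : ∀ P, Hom₁ P P)
    (comp₁ : ∀ {P Q R : Ob}, Hom₁ Q R → Hom₁ P Q → Hom₁ P R)
    (Hom₂ : ∀ {P Q : Ob}, Hom₁ P Q → Hom₁ P Q → Type w)
    (id₂ : ∀ {P Q : Ob} (f : Hom₁ P Q), Hom₂ f f)
    (vcomp : ∀ {P Q : Ob} {f g h : Hom₁ P Q}, Hom₂ f g → Hom₂ g h → Hom₂ f h)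
    (hcomp : ∀ {P Q R : Ob} {f₁ f₂ : Hom₁ P Q} {g₁ g₂ : Hom₁ Q R},
      Hom₂ f₁ f₂ → Hom₂ g₁ g₂ → Hom₂ (comp₁ g₁ f₁) (comp₁ g₂ f₂)) : Prop :=
  ∃ (_ : Bicategory.{w, v} Ob) (_ : Bicategory.Strict Ob)
    (e₁ : ∀ {P Q : Ob}, Hom₁ P Q ≃ (P ⟶ Q))
    (e₂ : ∀ {P Q : Ob} {f g : Hom₁ P Q}, Hom₂ f g ≃ (e₁ f ⟶ e₁ g))
    (_ : ∀ P : Ob, e₁ (id₁ P) = 𝟙 P)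
    (hcomp₁ : ∀ {P Q R : Ob} (g : Hom₁ Q R) (f : Hom₁ P Q), e₁ (comp₁ g f) = e₁ f ≫ e₁ g),
    (∀ {P Q : Ob} (f : Hom₁ P Q), e₂ (id₂ f) = 𝟙 (e₁ f)) ∧
    (∀ {P Q : Ob} {f g h : Hom₁ P Q} (θ : Hom₂ f g) (θ' : Hom₂ g h),
      e₂ (vcomp θ θ') = e₂ θ ≫ e₂ θ') ∧
    (∀ {P Q R : Ob} {f₁ f₂ : Hom₁ P Q} {g₁ g₂ : Hom₁ Q R} (θ : Hom₂ f₁ f₂) (η : Hom₂ g₁ g₂),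
      e₂ (hcomp θ η) = eqToHom (hcomp₁ g₁ f₁) ≫
        (Bicategory.whiskerRight (e₂ θ) (e₁ g₁) ≫ Bicategory.whiskerLeft (e₁ f₂) (e₂ η)) ≫
          eqToHom (hcomp₁ g₂ f₂).symm)

/-! The product of a bundle gerbe $(Q,Y)$ makes the fibres of $Q$ the arrows of a groupoid with
object set $Y$, in which scalars are central. A morphism $(\hat f,f)$ is then a functor. The
relation $w=\phi_{f,g}(v)$ is equivalent to $w\,\hat f(u)=\hat g(u)\,v$ for any one $u\in
P_{(x_1,x_2)}$ (`conj_eq_iff`): changing $u$ by $z$ multiplies both sides by $z$. So $\phi_{f,g}$ is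
independent of $u$, its cocycle condition is the pasting of two naturality squares, and a
$\phi$-invariant section of $\hat D_{f,g}$ is exactly a smooth natural transformation $f\Rightarrow
g$ (`lift_mul_hat`, `Mor.exists_lift_eq`). The compositions are those of functors and natural
transformations, and the interchange law is one instance of naturality.

Lifting a section of $D_{f,g}$ to $\hat D_{f,g}$ is injective because $\pi$ is surjective. Hence
every law for 2-arrows can be checked on lifts, fibre by fibre, and nothing depends on how $D_{f,g}$
was chosen. Composition of 1-arrows is strictly associative and unital, so all associators and
unitors are identities (`isTwoCategory_of_lift`).

The analysis rests on one notion, the germ at a point of a smooth section along a map into the base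
(`SecSmoothAt`). In a torsor two smooth sections differ by a smooth $\mathbb C^\times$-valued
function, so an equivariant map is smooth as soon as it sends one smooth local section near each
point to a smooth one (`Hom.ofLocal`).

Descent uses local sections of $\pi$. The fibre of the descended bundle at $m$ is $L_{c(m)}$ for an
arbitrary, possibly discontinuous, choice of $c(m)$ over $m$; its charts are charts of $L$ along
local smooth sections, transported to $c(m)$. Ratios are unchanged by transport, so $c$ does not
affect smoothness (`smoothFunAt_ratio`). Bundle maps and sections that are constant on the fibres of
$\pi$ descend in the same way (`Hom.exists_descent`, `Descended.exists_lift_eq`). -/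

/-! ## Germs of smooth functions, maps and sections -/

section SmoothGerms

variable {E : Type*} [NormedAddCommGroup E] [NormedSpace ℝ E]
  {H : Type*} [TopologicalSpace H] {I : ModelWithCorners ℝ E H}
  {N : Type*} [TopologicalSpace N] [ChartedSpace H N]
  {B : Type*} [TopologicalSpace B] {ι : B → N}
  {E' : Type*} [NormedAddCommGroup E'] [NormedSpace ℝ E']
  {H' : Type*} [TopologicalSpace H'] {I' : ModelWithCorners ℝ E' H'}
  {N' : Type*} [TopologicalSpace N'] [ChartedSpace H' N']
  {B' : Type*} [TopologicalSpace B'] {ι' : B' → N'}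
  {E'' : Type*} [NormedAddCommGroup E''] [NormedSpace ℝ E'']
  {H'' : Type*} [TopologicalSpace H''] {I'' : ModelWithCorners ℝ E'' H''}
  {N'' : Type*} [TopologicalSpace N''] [ChartedSpace H'' N'']
  {B'' : Type*} [TopologicalSpace B''] {ι'' : B'' → N''}

/-- `f : B → ℂˣ` is near `b` the restriction of a smooth function on the ambient manifold. -/
def SmoothFunAt (I : ModelWithCorners ℝ E H) (ι : B → N) (f : B → ℂˣ) (b : B) : Prop :=
  ∃ V : Set N, IsOpen V ∧ ι b ∈ V ∧ ∃ F : N → ℂ,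
    ContMDiffOn I 𝓘(ℝ, ℂ) ∞ F V ∧ ∀ᶠ b' in 𝓝 b, (f b' : ℂ) = F (ι b')

/-- `h : B' → B` is near `b` the restriction of a smooth map between the ambient manifolds. -/
def SmoothMapAt (I' : ModelWithCorners ℝ E' H') (ι' : B' → N') (I : ModelWithCorners ℝ E H)
    (ι : B → N) (h : B' → B) (b : B') : Prop :=
  ContinuousAt h b ∧ ∃ V : Set N', IsOpen V ∧ ι' b ∈ V ∧ ∃ K : N' → N,
    ContMDiffOn I' I ∞ K V ∧ ∀ᶠ b' in 𝓝 b, ι (h b') = K (ι' b')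

theorem smoothFunOn_iff {U : Set B} (hU : IsOpen U) {f : B → ℂˣ} :
    SmoothFunOn I ι U (fun b => (f b : ℂ)) ↔ ∀ b ∈ U, SmoothFunAt I ι f b := by
  refine forall₂_congr fun b hb => ?_
  rw [hU.nhdsWithin_eq hb]
  rfl

namespace SmoothFunAt

variable {f g : B → ℂˣ} {b : B}

theorem congr (hf : SmoothFunAt I ι f b) (h : ∀ᶠ b' in 𝓝 b, g b' = f b') :
    SmoothFunAt I ι g b := by
  obtain ⟨V, hV, hb, F, hF, he⟩ := hf
  refine ⟨V, hV, hb, F, hF, ?_⟩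
  filter_upwards [he, h] with b' h₁ h₂
  rw [h₂, h₁]

theorem one : SmoothFunAt I ι (fun _ => 1) b :=
  ⟨Set.univ, isOpen_univ, Set.mem_univ _, fun _ => 1, contMDiffOn_const, by simp⟩

theorem mul (hf : SmoothFunAt I ι f b) (hg : SmoothFunAt I ι g b) :
    SmoothFunAt I ι (fun b => f b * g b) b := by
  obtain ⟨V, hV, hbV, F, hF, hFe⟩ := hf
  obtain ⟨W, hW, hbW, G, hG, hGe⟩ := hg
  refine ⟨V ∩ W, hV.inter hW, ⟨hbV, hbW⟩, fun n => F n * G n,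
    (contDiff_mul (𝕜 := ℝ) (𝔸 := ℂ)).contMDiff.comp_contMDiffOn
      ((hF.mono Set.inter_subset_left).prodMk_space (hG.mono Set.inter_subset_right)), ?_⟩
  filter_upwards [hFe, hGe] with b' h₁ h₂
  rw [Units.val_mul, h₁, h₂]

theorem inv (hf : SmoothFunAt I ι f b) : SmoothFunAt I ι (fun b => (f b)⁻¹) b := by
  obtain ⟨V, hV, hbV, F, hF, hFe⟩ := hf
  -- The extension $F$ may vanish away from $B$, so the neighbourhood is shrunk to where it does
  -- not; $F(\iota b)=f(b)$ is a unit.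
  refine ⟨V ∩ F ⁻¹' {0}ᶜ, hF.continuousOn.isOpen_inter_preimage hV isOpen_compl_singleton,
    ⟨hbV, ?_⟩, fun n => (F n)⁻¹, ?_, ?_⟩
  · have := hFe.self_of_nhds
    simp [← this]
  · have hinv : ContMDiffOn 𝓘(ℝ, ℂ) 𝓘(ℝ, ℂ) ∞ (fun z : ℂ => z⁻¹) {0}ᶜ :=
      contMDiffOn_iff_contDiffOn.2 fun z hz => (contDiffAt_inv ℝ hz).contDiffWithinAt
    exact hinv.comp (hF.mono Set.inter_subset_left) fun _ hx => hx.2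
  · filter_upwards [hFe] with b' h₁
    rw [Units.val_inv_eq_inv_val, h₁]

theorem comp {h : B' → B} {b' : B'} (hf : SmoothFunAt I ι f (h b'))
    (hh : SmoothMapAt I' ι' I ι h b') : SmoothFunAt I' ι' (fun b' => f (h b')) b' := by
  obtain ⟨V, hV, hbV, F, hF, hFe⟩ := hf
  obtain ⟨hc, W, hW, hbW, K, hK, hKe⟩ := hh
  refine ⟨W ∩ K ⁻¹' V, hK.continuousOn.isOpen_inter_preimage hW hV, ⟨hbW, ?_⟩, F ∘ K,
    hF.comp (hK.mono Set.inter_subset_left) fun _ hx => hx.2, ?_⟩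
  · rw [Set.mem_preimage, ← hKe.self_of_nhds]
    exact hbV
  · filter_upwards [hc.eventually hFe, hKe] with b₁ h₁ h₂
    rw [h₁, h₂, Function.comp_apply]

end SmoothFunAt

namespace SmoothMapAt

theorem id (b : B) : SmoothMapAt I ι I ι (fun b => b) b :=
  ⟨continuousAt_id, Set.univ, isOpen_univ, Set.mem_univ _, fun n => n, contMDiffOn_id, by simp⟩

theorem comp {h : B' → B} {k : B'' → B'} {b : B''} (hh : SmoothMapAt I' ι' I ι h (k b))
    (hk : SmoothMapAt I'' ι'' I' ι' k b) : SmoothMapAt I'' ι'' I ι (fun b => h (k b)) b := by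
  obtain ⟨hc, V, hV, hbV, F, hF, hFe⟩ := hh
  obtain ⟨hc', W, hW, hbW, K, hK, hKe⟩ := hk
  refine ⟨ContinuousAt.comp (f := k) hc hc', W ∩ K ⁻¹' V,
    hK.continuousOn.isOpen_inter_preimage hW hV, ⟨hbW, ?_⟩, F ∘ K,
    hF.comp (hK.mono Set.inter_subset_left) fun _ hx => hx.2, ?_⟩
  · rw [Set.mem_preimage, ← hKe.self_of_nhds]
    exact hbV
  · filter_upwards [hc'.eventually hFe, hKe] with b₁ h₁ h₂
    rw [h₁, h₂, Function.comp_apply]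

theorem of_contMDiffOn {f : N' → N} {U : Set N'} (hU : IsOpen U) (hf : ContMDiffOn I' I ∞ f U)
    {x : N'} (hx : x ∈ U) : SmoothMapAt I' (_root_.id : N' → N') I (_root_.id : N → N) f x :=
  ⟨hf.continuousOn.continuousAt (hU.mem_nhds hx), U, hU, hx, f, hf, by simp⟩

theorem of_contMDiff {f : N' → N} (hf : ContMDiff I' I ∞ f) (x : N') :
    SmoothMapAt I' (_root_.id : N' → N') I (_root_.id : N → N) f x :=
  of_contMDiffOn isOpen_univ hf.contMDiffOn (Set.mem_univ x)

theorem prodMk {h : B'' → N} {k : B'' → N'} {b : B''}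
    (hh : SmoothMapAt I'' ι'' I (_root_.id : N → N) h b)
    (hk : SmoothMapAt I'' ι'' I' (_root_.id : N' → N') k b) :
    SmoothMapAt I'' ι'' (I.prod I') (_root_.id : N × N' → N × N') (fun b => (h b, k b)) b := by
  obtain ⟨hc, V, hV, hbV, F, hF, hFe⟩ := hh
  obtain ⟨hc', W, hW, hbW, K, hK, hKe⟩ := hk
  refine ⟨hc.prodMk hc', V ∩ W, hV.inter hW, ⟨hbV, hbW⟩, fun n => (F n, K n),
    (hF.mono Set.inter_subset_left).prodMk (hK.mono Set.inter_subset_right), ?_⟩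
  filter_upwards [hFe, hKe] with b₁ h₁ h₂
  exact Prod.ext h₁ h₂

theorem subtypeMk {p : N → Prop} {h : B' → N} (hp : ∀ b, p (h b)) {b : B'}
    (hh : SmoothMapAt I' ι' I (_root_.id : N → N) h b) :
    SmoothMapAt I' ι' I (Subtype.val : {x // p x} → N) (fun b => ⟨h b, hp b⟩) b :=
  ⟨Topology.IsInducing.subtypeVal.continuousAt_iff.2 hh.1, hh.2⟩

end SmoothMapAt

theorem BaseMap.smoothMapAt (h : BaseMap I' ι' I ι) (b : B') : SmoothMapAt I' ι' I ι h.toFun b :=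
  ⟨h.continuous_toFun.continuousAt, Set.univ, isOpen_univ, Set.mem_univ _, h.ambient,
    h.smooth_ambient.contMDiffOn, by simp [h.comm]⟩

/-! ### Smooth germs of sections along a map -/

namespace CxBundle

/-- The section `t` of `L` along `h` is smooth near `b`. -/
structure SecSmoothAt (L : CxBundle.{v} I ι) (I' : ModelWithCorners ℝ E' H') (ι' : B' → N')
    (h : B' → B) (t : ∀ b', L.fiber (h b')) (b : B') : Prop where
  map : SmoothMapAt I' ι' I ι h b
  sec : ∀ σ ∈ L.atlas, h b ∈ σ.1 → ∃ g : B' → ℂˣ, (∀ b', t b' = g b' • σ.2 (h b')) ∧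
    SmoothFunAt I' ι' g b

theorem smul_left_cancel (L : CxBundle.{v} I ι) {b : B} {p : L.fiber b} {y z : ℂˣ}
    (h : y • p = z • p) : y = z :=
  (L.torsor b p (z • p)).unique h.symm rfl

theorem exists_smul_eq (L : CxBundle.{v} I ι) {A : Type*} {h : A → B} (s t : ∀ b, L.fiber (h b)) :
    ∃ g : A → ℂˣ, ∀ b, t b = g b • s b := by
  choose g hg using fun b => (L.torsor (h b) (s b) (t b)).exists
  exact ⟨g, hg⟩

/-- Freeness of the action makes the transition function unique, so any function relating the two
charts is the smooth one supplied by the atlas. -/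
theorem transition_smoothFunAt (L : CxBundle.{v} I ι) {σ τ : Set B × (∀ b, L.fiber b)}
    (hσ : σ ∈ L.atlas) (hτ : τ ∈ L.atlas) {g : B → ℂˣ} (hg : ∀ b, τ.2 b = g b • σ.2 b) {b : B}
    (hbσ : b ∈ σ.1) (hbτ : b ∈ τ.1) : SmoothFunAt I ι g b := by
  obtain ⟨g', hg', hs⟩ := L.transition σ hσ τ hτ
  obtain rfl : g = g' := funext fun b => L.smul_left_cancel ((hg b).symm.trans (hg' b))
  exact (smoothFunOn_iff ((L.isOpen_atlas τ hτ).inter (L.isOpen_atlas σ hσ))).1 hs b ⟨hbτ, hbσ⟩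

namespace SecSmoothAt

variable {L : CxBundle.{v} I ι} {h : B' → B} {s t : ∀ b', L.fiber (h b')} {b : B'}

/-- One chart suffices, because the change to any other chart is a smooth transition function
composed with $h$. -/
theorem mk_of_atlas (hh : SmoothMapAt I' ι' I ι h b) {σ : Set B × (∀ b, L.fiber b)}
    (hσ : σ ∈ L.atlas) (hb : h b ∈ σ.1) {g : B' → ℂˣ} (hg : ∀ b', t b' = g b' • σ.2 (h b'))
    (hs : SmoothFunAt I' ι' g b) : L.SecSmoothAt I' ι' h t b := by
  refine ⟨hh, fun τ hτ hbτ => ?_⟩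
  obtain ⟨k, hk, -⟩ := L.transition τ hτ σ hσ
  refine ⟨fun b => g b * k (h b), fun b => by rw [hg, hk, mul_smul], hs.mul ?_⟩
  exact (L.transition_smoothFunAt hτ hσ hk hbτ hb).comp hh

theorem atlas {σ : Set B × (∀ b, L.fiber b)} (hσ : σ ∈ L.atlas) (hh : SmoothMapAt I' ι' I ι h b)
    (hb : h b ∈ σ.1) : L.SecSmoothAt I' ι' h (fun b => σ.2 (h b)) b :=
  mk_of_atlas hh hσ hb (fun _ => (one_smul _ _).symm) SmoothFunAt.one

theorem smul (ht : L.SecSmoothAt I' ι' h t b) {g : B' → ℂˣ} (hg : SmoothFunAt I' ι' g b) :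
    L.SecSmoothAt I' ι' h (fun b => g b • t b) b := by
  refine ⟨ht.map, fun σ hσ hb => ?_⟩
  obtain ⟨k, hk, hs⟩ := ht.sec σ hσ hb
  exact ⟨fun b => g b * k b, fun b => by rw [hk, mul_smul], hg.mul hs⟩

theorem of_smul_eq (ht : L.SecSmoothAt I' ι' h t b) {g : B' → ℂˣ} (hg : SmoothFunAt I' ι' g b)
    (hs : ∀ b, s b = g b • t b) : L.SecSmoothAt I' ι' h s b := by
  obtain rfl : s = fun b => g b • t b := funext hs
  exact ht.smul hg

/-- Two sections along the same map, smooth near `b`, differ by a smooth function. -/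
theorem ratio (hs : L.SecSmoothAt I' ι' h s b) (ht : L.SecSmoothAt I' ι' h t b) {g : B' → ℂˣ}
    (hg : ∀ b, t b = g b • s b) : SmoothFunAt I' ι' g b := by
  obtain ⟨σ, hσ, hb⟩ := L.cover (h b)
  obtain ⟨k, hk, hks⟩ := hs.sec σ hσ hb
  obtain ⟨l, hl, hls⟩ := ht.sec σ hσ hb
  refine (hls.mul hks.inv).congr (.of_forall fun b' => ?_)
  have : l b' = g b' * k b' :=
    L.smul_left_cancel (p := σ.2 (h b')) (by rw [← hl, hg, hk, mul_smul])
  rw [this, mul_inv_cancel_right]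

theorem comp {k : B'' → B'} {c : B''}
    (hs : L.SecSmoothAt I' ι' h s (k c)) (hk : SmoothMapAt I'' ι'' I' ι' k c) :
    L.SecSmoothAt I'' ι'' (fun c => h (k c)) (fun c => s (k c)) c := by
  refine ⟨hs.map.comp hk, fun σ hσ hb => ?_⟩
  obtain ⟨g, hg, hgs⟩ := hs.sec σ hσ hb
  exact ⟨fun c => g (k c), fun c => hg _, hgs.comp hk⟩

/-- Meant for $k=\pi\circ s$ with $s$ a section of $\pi$: this is only propositionally the identity,
and substituting it here avoids transports between fibres. -/
theorem of_comp_eq_id {s : ∀ b, L.fiber b} {k : B → B} (hk : ∀ b, k b = b) {b : B}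
    (hs : L.SecSmoothAt I ι k (fun b => s (k b)) b) : L.SecSmoothAt I ι (fun b => b) s b := by
  obtain rfl : k = fun b => b := funext hk
  exact hs

end SecSmoothAt

theorem exists_secSmoothAt (L : CxBundle.{v} I ι) {h : B' → B} {b : B'}
    (hh : SmoothMapAt I' ι' I ι h b) :
    ∃ t : ∀ b, L.fiber (h b), L.SecSmoothAt I' ι' h t b := by
  obtain ⟨σ, hσ, hb⟩ := L.cover (h b)
  exact ⟨_, SecSmoothAt.atlas hσ hh hb⟩

theorem isSmoothOn_iff (L : CxBundle.{v} I ι) {U : Set B} (hU : IsOpen U)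
    {s : ∀ b, L.fiber b} :
    L.IsSmoothOn U s ↔ ∀ b ∈ U, L.SecSmoothAt I ι (fun b => b) s b := by
  constructor
  · refine fun hs b hb => ⟨SmoothMapAt.id b, fun σ hσ hbσ => ?_⟩
    obtain ⟨g, hg, hgs⟩ := hs σ hσ
    exact ⟨g, hg, (smoothFunOn_iff (hU.inter (L.isOpen_atlas σ hσ))).1 hgs b ⟨hb, hbσ⟩⟩
  · intro hs σ hσ
    obtain ⟨g, hg⟩ := L.exists_smul_eq (h := fun b => b) σ.2 s
    refine ⟨g, hg, (smoothFunOn_iff (hU.inter (L.isOpen_atlas σ hσ))).2 fun b hb => ?_⟩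
    exact (SecSmoothAt.atlas hσ (SmoothMapAt.id b) hb.2).ratio (hs b hb.1) hg

/-- The charts of the pullback are pulled-back charts and the fibres agree definitionally.
Smoothness of $k$ is assumed since it cannot be recovered from that of $h\circ k$. -/
theorem secSmoothAt_pullback_iff {L : CxBundle.{v} I ι} {h : BaseMap I' ι' I ι} {k : B'' → B'}
    {t : ∀ c, (L.pullback h).fiber (k c)} {c : B''} (hk : SmoothMapAt I'' ι'' I' ι' k c) :
    (L.pullback h).SecSmoothAt I'' ι'' k t c ↔
      L.SecSmoothAt I'' ι'' (fun c => h.toFun (k c)) t c := by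
  constructor
  · exact fun ht => ⟨(h.smoothMapAt _).comp hk, fun σ hσ hb => ht.sec _ ⟨σ, hσ, rfl⟩ hb⟩
  · refine fun ht => ⟨hk, ?_⟩
    rintro _ ⟨σ, hσ, rfl⟩ hb
    exact ht.sec σ hσ hb

theorem SecSmoothAt.tmul {L : CxBundle.{v} I ι} {K : CxBundle.{w} I ι} {h : B' → B}
    {s : ∀ b, L.fiber (h b)} {t : ∀ b, K.fiber (h b)} {b : B'} (hs : L.SecSmoothAt I' ι' h s b)
    (ht : K.SecSmoothAt I' ι' h t b) :
    (L.tensor K).SecSmoothAt I' ι' h (fun b => CxBundle.tmul (s b) (t b)) b := by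
  refine ⟨hs.map, ?_⟩
  rintro _ ⟨σ, hσ, τ, hτ, rfl⟩ hb
  obtain ⟨g, hg, hgs⟩ := hs.sec σ hσ hb.1
  obtain ⟨k, hk, hks⟩ := ht.sec τ hτ hb.2
  refine ⟨fun b => k b * g b, fun b => ?_, hks.mul hgs⟩
  change CxBundle.tmul (s b) (t b) = (k b * g b) • CxBundle.tmul (σ.2 (h b)) (τ.2 (h b))
  rw [hg, hk, tmul_smul, mul_smul, smul_tmul (g b)]

namespace Hom

variable {L : CxBundle.{v} I ι} {K : CxBundle.{w} I ι}

theorem injective (φ : Hom L K) (b : B) : Function.Injective (φ.toFun b) := by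
  intro p q h
  obtain ⟨z, rfl, -⟩ := L.torsor b p q
  rw [φ.equivariant] at h
  have : (1 : ℂˣ) = z := K.smul_left_cancel ((one_smul _ _).trans h)
  rw [← this, one_smul]

/-- The smoothness field of a morphism concerns only sections over open sets of the base. It is
applied to a chart section, which is then composed with $h$ and rescaled. -/
theorem secSmoothAt (φ : Hom L K) {h : B' → B} {t : ∀ b, L.fiber (h b)} {b : B'}
    (ht : L.SecSmoothAt I' ι' h t b) :
    K.SecSmoothAt I' ι' h (fun b => φ.toFun (h b) (t b)) b := by
  obtain ⟨σ, hσ, hb⟩ := L.cover (h b)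
  obtain ⟨g, hg, hgs⟩ := ht.sec σ hσ hb
  have hσs := (K.isSmoothOn_iff (L.isOpen_atlas σ hσ)).1
    (φ.smooth σ.1 σ.2 (L.isOpen_atlas σ hσ) (fun ρ hρ => L.transition ρ hρ σ hσ)) (h b) hb
  exact (SecSmoothAt.comp (h := fun b => b) hσs ht.map).of_smul_eq hgs
    fun b => by rw [hg, φ.equivariant]

/-- Smoothness is reflected too: by equivariance, the ratio of $t$ to a smooth reference section is
the ratio of their images. -/
theorem secSmoothAt_iff (φ : Hom L K) {h : B' → B} {t : ∀ b, L.fiber (h b)} {b : B'} :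
    K.SecSmoothAt I' ι' h (fun b => φ.toFun (h b) (t b)) b ↔ L.SecSmoothAt I' ι' h t b := by
  refine ⟨fun ht => ?_, φ.secSmoothAt⟩
  obtain ⟨s, hs⟩ := L.exists_secSmoothAt ht.map
  obtain ⟨g, hg⟩ := L.exists_smul_eq s t
  exact hs.of_smul_eq ((φ.secSmoothAt hs).ratio ht fun b => by rw [hg, φ.equivariant]) hg

/-- An equivariant map which near each point carries some smooth section to a smooth section. -/
def ofLocal (f : ∀ b, L.fiber b → K.fiber b)
    (hf : ∀ b (z : ℂˣ) (p : L.fiber b), f b (z • p) = z • f b p)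
    (hs : ∀ b, ∃ t : ∀ b, L.fiber b, L.SecSmoothAt I ι (fun b => b) t b ∧
      K.SecSmoothAt I ι (fun b => b) (fun b => f b (t b)) b) : Hom L K where
  toFun := f
  equivariant := hf
  smooth U s hU h := by
    refine (K.isSmoothOn_iff hU).2 fun b hb => ?_
    obtain ⟨t, ht, hft⟩ := hs b
    obtain ⟨g, hg⟩ := L.exists_smul_eq (h := fun b => b) t s
    exact hft.of_smul_eq (ht.ratio ((L.isSmoothOn_iff hU).1 h b hb) hg)
      fun b => by rw [hg, hf]

end Hom

end CxBundle

end SmoothGerms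

/-! ## Descent along smooth surjections with local sections -/

section Descent

variable {EM : Type*} [NormedAddCommGroup EM] [NormedSpace ℝ EM]
  {M : Type*}
  {E : Type*} [NormedAddCommGroup E] [NormedSpace ℝ E]
  {X : Type*} [TopologicalSpace X] [ChartedSpace E X]
  {E' : Type*} [NormedAddCommGroup E'] [NormedSpace ℝ E']
  {H' : Type*} [TopologicalSpace H'] {I' : ModelWithCorners ℝ E' H'}
  {N' : Type*} [TopologicalSpace N'] [ChartedSpace H' N']
  {B' : Type*} [TopologicalSpace B'] {ι' : B' → N'}

theorem FibSq.smoothMapAt_mk {π : X → M} {a b : B' → X} (h : ∀ b', π (a b') = π (b b')) {b' : B'}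
    (ha : SmoothMapAt I' ι' 𝓘(ℝ, E) (id : X → X) a b')
    (hb : SmoothMapAt I' ι' 𝓘(ℝ, E) (id : X → X) b b') :
    SmoothMapAt I' ι' (𝓘(ℝ, E).prod 𝓘(ℝ, E)) (FibSq.incl π) (fun b' => FibSq.mk (h b')) b' :=
  (ha.prodMk hb).subtypeMk h

theorem FibCube.smoothMapAt_mk {π : X → M} {a b c : B' → X} (h : ∀ b', π (a b') = π (b b'))
    (h' : ∀ b', π (b b') = π (c b')) {b' : B'}
    (ha : SmoothMapAt I' ι' 𝓘(ℝ, E) (id : X → X) a b')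
    (hb : SmoothMapAt I' ι' 𝓘(ℝ, E) (id : X → X) b b')
    (hc : SmoothMapAt I' ι' 𝓘(ℝ, E) (id : X → X) c b') :
    SmoothMapAt I' ι' (𝓘(ℝ, E).prod (𝓘(ℝ, E).prod 𝓘(ℝ, E))) (FibCube.incl π)
      (fun b' => FibCube.mk (h b') (h' b')) b' :=
  (ha.prodMk (hb.prodMk hc)).subtypeMk fun b' => ⟨h b', h' b'⟩

/-! ### Transport along a descent isomorphism -/

namespace DescentIso

variable {π : X → M} {L : CxBundle.{v} 𝓘(ℝ, E) (id : X → X)} (d : DescentIso π L)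

/-- The descent isomorphism on fibres, `L_{x₁} → L_{x₂}`. -/
def trans {x₁ x₂ : X} (h : π x₁ = π x₂) (v : L.fiber x₁) : L.fiber x₂ :=
  d.φ.toFun (FibSq.mk h) v

theorem trans_smul {x₁ x₂ : X} (h : π x₁ = π x₂) (z : ℂˣ) (v : L.fiber x₁) :
    d.trans h (z • v) = z • d.trans h v :=
  d.φ.equivariant (FibSq.mk h) z v

theorem trans_trans {x₁ x₂ x₃ : X} (h₁₂ : π x₁ = π x₂) (h₂₃ : π x₂ = π x₃) (v : L.fiber x₁) :
    d.trans h₂₃ (d.trans h₁₂ v) = d.trans (h₁₂.trans h₂₃) v :=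
  d.cocycle h₁₂ h₂₃ v

theorem trans_injective {x₁ x₂ : X} (h : π x₁ = π x₂) : Function.Injective (d.trans h) :=
  d.φ.injective (FibSq.mk h)

theorem secSmoothAt_trans {a b : B' → X} (h : ∀ b', π (a b') = π (b b')) {b' : B'}
    {t : ∀ b', L.fiber (a b')} (ht : L.SecSmoothAt I' ι' a t b')
    (hb : SmoothMapAt I' ι' 𝓘(ℝ, E) (id : X → X) b b') :
    L.SecSmoothAt I' ι' b (fun b' => d.trans (h b') (t b')) b' := by
  have hk := FibSq.smoothMapAt_mk h ht.map hb
  exact (CxBundle.secSmoothAt_pullback_iff hk).1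
    (d.φ.secSmoothAt ((CxBundle.secSmoothAt_pullback_iff (h := FibSq.π₂ π) hk).2 ht))

/-- The comparison in $L_{c}$ can be moved back to $L_{a}$ by injectivity and the cocycle condition.
There it involves only smooth data, so no regularity of $c$ is needed. -/
theorem smoothFunAt_ratio {a b c : B' → X} (ha : ∀ b', π (a b') = π (c b'))
    (hb : ∀ b', π (b b') = π (c b')) {b' : B'} {s : ∀ b', L.fiber (a b')}
    {t : ∀ b', L.fiber (b b')} (hs : L.SecSmoothAt I' ι' a s b') (ht : L.SecSmoothAt I' ι' b t b')
    {g : B' → ℂˣ} (hg : ∀ b', d.trans (hb b') (t b') = g b' • d.trans (ha b') (s b')) :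
    SmoothFunAt I' ι' g b' := by
  refine hs.ratio (d.secSmoothAt_trans (fun b' => (hb b').trans (ha b').symm) ht hs.map)
    fun b' => d.trans_injective (ha b') ?_
  rw [d.trans_trans, d.trans_smul]
  exact hg b'

end DescentIso

variable [TopologicalSpace M] [ChartedSpace EM M]

/-- `π : X → M` is surjective and admits local smooth sections. They are recorded as global
set-theoretic sections which are smooth on an open set. -/
def HasSmoothSections (EM E : Type*) [NormedAddCommGroup EM] [NormedSpace ℝ EM]
    [NormedAddCommGroup E] [NormedSpace ℝ E] {M X : Type*} [TopologicalSpace M] [ChartedSpace EM M]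
    [TopologicalSpace X] [ChartedSpace E X] (π : X → M) : Prop :=
  ∀ m : M, ∃ (U : Set M) (s : M → X), IsOpen U ∧ m ∈ U ∧ (∀ m', π (s m') = m') ∧
    ∀ m' ∈ U, SmoothMapAt 𝓘(ℝ, EM) (id : M → M) 𝓘(ℝ, E) (id : X → X) s m'

theorem HasSmoothSections.surjective {π : X → M} (hs : HasSmoothSections EM E π) :
    Function.Surjective π := fun m => by
  obtain ⟨-, s, -, -, h, -⟩ := hs m
  exact ⟨s m, h m⟩

/-! ### Existence of the descended bundle -/

namespace DescentIso

variable {π : X → M} {L : CxBundle.{v} 𝓘(ℝ, E) (id : X → X)} (d : DescentIso π L)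

/-- The descended bundle, for a choice `c` of base points in the fibres of `π`. -/
def descent (hs : HasSmoothSections EM E π) (c : M → X) (hc : ∀ m, π (c m) = m) :
    CxBundle.{v} 𝓘(ℝ, EM) (id : M → M) where
  fiber m := L.fiber (c m)
  torsor m := L.torsor (c m)
  -- A chart comes from a section $s$ of $\pi$, smooth on $U$, and a chart $\sigma$ of $L$: its
  -- value at $m$ is $\sigma(s(m))$ transported from $s(m)$ to the base point $c(m)$.
  atlas := {ρ | ∃ (U : Set M) (s : M → X) (h : ∀ m, π (s m) = m), IsOpen U ∧
    (∀ m ∈ U, SmoothMapAt 𝓘(ℝ, EM) (id : M → M) 𝓘(ℝ, E) (id : X → X) s m) ∧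
    ∃ σ ∈ L.atlas, ρ = (U ∩ s ⁻¹' σ.1,
      fun m => d.trans ((h m).trans (hc m).symm) (σ.2 (s m)))}
  isOpen_atlas := by
    rintro _ ⟨U, s, h, hU, hsm, σ, hσ, rfl⟩
    exact ContinuousOn.isOpen_inter_preimage
      (fun m hm => (hsm m hm).1.continuousWithinAt) hU (L.isOpen_atlas σ hσ)
  cover m := by
    obtain ⟨U, s, hU, hm, h, hsm⟩ := hs m
    obtain ⟨σ, hσ, hb⟩ := L.cover (s m)
    exact ⟨_, ⟨U, s, h, hU, hsm, σ, hσ, rfl⟩, hm, hb⟩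
  transition := by
    rintro ρ hρ ρ' hρ'
    obtain ⟨g, hg⟩ := L.exists_smul_eq (h := c) ρ.2 ρ'.2
    refine ⟨g, hg, ?_⟩
    obtain ⟨U, s, h, hU, hsm, σ, hσ, rfl⟩ := hρ
    obtain ⟨U', s', h', hU', hsm', σ', hσ', rfl⟩ := hρ'
    refine (smoothFunOn_iff ?_).2 fun m hm => ?_
    · exact (ContinuousOn.isOpen_inter_preimage
        (fun m hm => (hsm' m hm).1.continuousWithinAt) hU' (L.isOpen_atlas σ' hσ')).inter
        (ContinuousOn.isOpen_inter_preimage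
        (fun m hm => (hsm m hm).1.continuousWithinAt) hU (L.isOpen_atlas σ hσ))
    · exact d.smoothFunAt_ratio (fun m => (h m).trans (hc m).symm)
        (fun m => (h' m).trans (hc m).symm)
        (CxBundle.SecSmoothAt.atlas hσ (hsm m hm.2.1) hm.2.2)
        (CxBundle.SecSmoothAt.atlas hσ' (hsm' m hm.1.1) hm.1.2) hg

theorem nonempty_descended (hπ : ContMDiff 𝓘(ℝ, E) 𝓘(ℝ, EM) ∞ π)
    (hs : HasSmoothSections EM E π) : Nonempty (Descended hπ d) := by
  choose c hc using hs.surjective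
  have hπs : ∀ x, SmoothMapAt 𝓘(ℝ, E) (id : X → X) 𝓘(ℝ, EM) (id : M → M) π x :=
    SmoothMapAt.of_contMDiff hπ
  refine ⟨⟨d.descent hs c hc, CxBundle.Hom.ofLocal (fun x => d.trans (hc (π x)).symm)
    (fun x => d.trans_smul _) fun x => ?_, fun {x₁ x₂} h v => ?_⟩⟩
  · obtain ⟨t, ht⟩ := L.exists_secSmoothAt (SmoothMapAt.id (I := 𝓘(ℝ, E)) (ι := (id : X → X)) x)
    refine ⟨t, ht, (CxBundle.secSmoothAt_pullback_iff (SmoothMapAt.id x)).2 ?_⟩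
    obtain ⟨U, s, hU, hm, h, hsm⟩ := hs (π x)
    obtain ⟨σ, hσ, hb⟩ := L.cover (s (π x))
    obtain ⟨g, hg⟩ := L.exists_smul_eq (h := fun x => c (π x))
      (fun x => d.trans ((h (π x)).trans (hc (π x)).symm) (σ.2 (s (π x))))
      (fun x => d.trans (hc (π x)).symm (t x))
    refine CxBundle.SecSmoothAt.mk_of_atlas (hπs x) ⟨U, s, h, hU, hsm, σ, hσ, rfl⟩ ⟨hm, hb⟩ hg ?_
    exact d.smoothFunAt_ratio (fun x => (h (π x)).trans (hc (π x)).symm)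
      (fun x => (hc (π x)).symm)
      (CxBundle.SecSmoothAt.atlas hσ ((hsm _ hm).comp (hπs x)) hb) ht hg
  -- The points $\pi x_1$ and $\pi x_2$ are generalised to variables so that their equality can be
  -- substituted; the claim is then the cocycle condition.
  · have key : ∀ {m₁ m₂ : M} (h₁ : π x₁ = m₁) (h₂ : π x₂ = m₂), m₁ = m₂ →
        (⟨m₂, d.trans (h₂.trans (hc m₂).symm) (d.trans h v)⟩ : Σ m, L.fiber (c m)) =
          ⟨m₁, d.trans (h₁.trans (hc m₁).symm) v⟩ := by
      rintro m₁ m₂ h₁ h₂ rfl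
      rw [d.trans_trans]
    exact key rfl rfl h

end DescentIso

/-- A morphism `π⁻¹K → π⁻¹K'` which is constant on the fibres of `π` descends to `K → K'`. -/
theorem CxBundle.Hom.exists_descent {π : X → M} (hπ : ContMDiff 𝓘(ℝ, E) 𝓘(ℝ, EM) ∞ π)
    (hs : HasSmoothSections EM E π) {K : CxBundle.{v} 𝓘(ℝ, EM) (id : M → M)}
    {K' : CxBundle.{w} 𝓘(ℝ, EM) (id : M → M)}
    (f : Hom (K.pullback (BaseMap.ofContMDiff π hπ)) (K'.pullback (BaseMap.ofContMDiff π hπ)))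
    (hf : ∀ {x₁ x₂ : X} (k₁ : K.fiber (π x₁)) (k₂ : K.fiber (π x₂)),
      (⟨π x₁, k₁⟩ : Σ m, K.fiber m) = ⟨π x₂, k₂⟩ →
        (⟨π x₁, f.toFun x₁ k₁⟩ : Σ m, K'.fiber m) = ⟨π x₂, f.toFun x₂ k₂⟩) :
    ∃ F : Hom K K', ∀ x (k : K.fiber (π x)), F.toFun (π x) k = f.toFun x k := by
  -- The value of $F$ at $k$ is that of $f$ at any point over $m$. Stating this in the total spaces
  -- avoids casts between fibres over equal base points.
  have hex : ∀ m (k : K.fiber m), ∃ k' : K'.fiber m, ∀ x (k₀ : K.fiber (π x)),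
      (⟨π x, k₀⟩ : Σ m, K.fiber m) = ⟨m, k⟩ →
        (⟨π x, f.toFun x k₀⟩ : Σ m, K'.fiber m) = ⟨m, k'⟩ := by
    intro m k
    obtain ⟨x, rfl⟩ := hs.surjective m
    exact ⟨f.toFun x k, fun x' k₀ h => hf _ _ h⟩
  choose F hF using hex
  have hFf : ∀ x (k : K.fiber (π x)), F (π x) k = f.toFun x k := fun x k =>
    (sigma_mk_injective (hF _ k x k rfl)).symm
  refine ⟨ofLocal F (fun m z k => ?_) fun m => ?_, hFf⟩
  · obtain ⟨x, rfl⟩ := hs.surjective m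
    rw [hFf, hFf]
    exact f.equivariant x z k
  · obtain ⟨t, ht⟩ := K.exists_secSmoothAt
      (SmoothMapAt.id (I := 𝓘(ℝ, EM)) (ι := (id : M → M)) m)
    refine ⟨t, ht, ?_⟩
    -- Smoothness is tested along a local section $s$: $F$ along $\pi\circ s=\mathrm{id}$ is $f$
    -- along $s$.
    obtain ⟨U, s, hU, hm, h, hsm⟩ := hs m
    refine SecSmoothAt.of_comp_eq_id h ?_
    have hc : SmoothMapAt 𝓘(ℝ, EM) (id : M → M) 𝓘(ℝ, EM) (id : M → M) (fun m => π (s m)) m :=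
      (SmoothMapAt.of_contMDiff hπ _).comp (hsm m hm)
    have h₁ : K.SecSmoothAt 𝓘(ℝ, EM) (id : M → M) (fun m => π (s m)) (fun m => t (π (s m))) m :=
      SecSmoothAt.comp (h := fun m => m) (k := fun m => π (s m)) (by rwa [h m]) hc
    have h₂ := (secSmoothAt_pullback_iff (hsm m hm)).1
      (f.secSmoothAt ((secSmoothAt_pullback_iff (h := BaseMap.ofContMDiff π hπ) (hsm m hm)).2 h₁))
    simp only [hFf]
    exact h₂

/-! ### Sections of the descended bundle and their lifts -/

namespace Descended

variable {π : X → M} {hπ : ContMDiff 𝓘(ℝ, E) 𝓘(ℝ, EM) ∞ π}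
  {L : CxBundle.{v} 𝓘(ℝ, E) (id : X → X)} {d : DescentIso π L} (D : Descended hπ d)

theorem ψ_lift (θ : D.bundle.GlobalSection) (x : X) : D.ψ.toFun x (D.lift θ x) = θ.1 (π x) :=
  (D.ψ.exists_preimage x (θ.1 (π x))).choose_spec

theorem lift_eq_iff (θ : D.bundle.GlobalSection) (x : X) (v : L.fiber x) :
    D.lift θ x = v ↔ θ.1 (π x) = D.ψ.toFun x v := by
  rw [← D.ψ_lift]
  exact (D.ψ.injective x).eq_iff.symm

theorem ext_lift (hs : Function.Surjective π) {θ η : D.bundle.GlobalSection}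
    (h : ∀ x, D.lift θ x = D.lift η x) : θ = η := by
  refine Subtype.ext (funext fun m => ?_)
  obtain ⟨x, rfl⟩ := hs m
  rw [← D.ψ_lift, h, D.ψ_lift]

/-- After applying $\psi$, which identifies $\phi(v)$ with $v$ in the total space of $D$, both sides
become the value of $\theta$ at the common base point. -/
theorem trans_lift (θ : D.bundle.GlobalSection) {x₁ x₂ : X} (h : π x₁ = π x₂) :
    d.trans h (D.lift θ x₁) = D.lift θ x₂ := by
  refine D.ψ.injective x₂ (sigma_mk_injective (i := π x₂)
    (β := D.bundle.fiber) ((D.compat h _).trans ?_))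
  rw [ψ_lift, ψ_lift, h]

theorem secSmoothAt_lift (θ : D.bundle.GlobalSection) (x : X) :
    L.SecSmoothAt 𝓘(ℝ, E) (id : X → X) (fun x => x) (D.lift θ) x := by
  refine D.ψ.secSmoothAt_iff.1 ?_
  simp only [ψ_lift]
  refine (CxBundle.secSmoothAt_pullback_iff (SmoothMapAt.id x)).2 ?_
  exact CxBundle.SecSmoothAt.comp (h := fun m => m)
    ((D.bundle.isSmoothOn_iff isOpen_univ).1 θ.2 (π x) trivial) (SmoothMapAt.of_contMDiff hπ x)

/-- Converse of `trans_lift`: by invariance $\psi(t(x))$ depends only on $\pi(x)$, and it is smooth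
on $M$ because it is smooth along local sections of $\pi$. -/
theorem exists_lift_eq (hs : HasSmoothSections EM E π) (t : ∀ x, L.fiber x)
    (ht : ∀ x, L.SecSmoothAt 𝓘(ℝ, E) (id : X → X) (fun x => x) t x)
    (hd : ∀ {x₁ x₂ : X} (h : π x₁ = π x₂), d.trans h (t x₁) = t x₂) :
    ∃ θ : D.bundle.GlobalSection, ∀ x, D.lift θ x = t x := by
  have hex : ∀ m, ∃ k : D.bundle.fiber m, ∀ x, π x = m →
      (⟨π x, D.ψ.toFun x (t x)⟩ : Σ m, D.bundle.fiber m) = ⟨m, k⟩ := by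
    intro m
    obtain ⟨x, rfl⟩ := hs.surjective m
    refine ⟨D.ψ.toFun x (t x), fun x' h => ?_⟩
    exact (congrArg (fun v => (⟨π x', D.ψ.toFun x' v⟩ : Σ m, D.bundle.fiber m))
      (hd h.symm).symm).trans (D.compat h.symm (t x))
  choose θ hθ using hex
  have hθψ : ∀ x, θ (π x) = D.ψ.toFun x (t x) := fun x =>
    (sigma_mk_injective (hθ _ x rfl)).symm
  refine ⟨⟨θ, (D.bundle.isSmoothOn_iff isOpen_univ).2 fun m _ => ?_⟩,
    fun x => (D.lift_eq_iff _ _ _).2 (hθψ x)⟩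
  obtain ⟨U, s, hU, hm, h, hsm⟩ := hs m
  refine CxBundle.SecSmoothAt.of_comp_eq_id h ?_
  simp only [hθψ]
  exact (CxBundle.secSmoothAt_pullback_iff (hsm m hm)).1
    (D.ψ.secSmoothAt (CxBundle.SecSmoothAt.comp (h := fun x => x) (ht (s m)) (hsm m hm)))

end Descended

end Descent

/-! ## Calculus in bundle gerbes -/

namespace BundleGerbe

variable {EM : Type*} [NormedAddCommGroup EM] [NormedSpace ℝ EM]
  {M : Type*} [TopologicalSpace M] [ChartedSpace EM M]
  {P Q R : BundleGerbe.{u} EM M}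

/-! ### Groupoid laws -/

section Algebra

theorem mul_assoc {x₁ x₂ x₃ x₄ : P.X} {h₁₂ : P.π x₁ = P.π x₂} {h₂₃ : P.π x₂ = P.π x₃}
    {h₃₄ : P.π x₃ = P.π x₄} (u₃₄ : P.Fib h₃₄) (u₂₃ : P.Fib h₂₃) (u₁₂ : P.Fib h₁₂) :
    P.mul (P.mul u₃₄ u₂₃) u₁₂ = P.mul u₃₄ (P.mul u₂₃ u₁₂) :=
  (P.assoc h₁₂ h₂₃ h₃₄ u₃₄ u₂₃ u₁₂).symm

theorem mul_one {x y : P.X} {h : P.π x = P.π y} (p : P.Fib h) : P.mul p (P.one x) = p :=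
  (P.exists_one x).choose_spec.1 h p

theorem one_mul {x y : P.X} {h : P.π y = P.π x} (p : P.Fib h) : P.mul (P.one x) p = p :=
  (P.exists_one x).choose_spec.2 h p

theorem mul_inv {x₁ x₂ : P.X} {h : P.π x₁ = P.π x₂} (p : P.Fib h) :
    P.mul p (P.inv p) = P.one x₂ :=
  (P.exists_inv p).choose_spec

theorem inv_mul {x₁ x₂ : P.X} {h : P.π x₁ = P.π x₂} (p : P.Fib h) :
    P.mul (P.inv p) p = P.one x₁ := by
  rw [← mul_one (P.mul (P.inv p) p), ← mul_inv (P.inv p), mul_assoc,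
    ← mul_assoc p (P.inv p) (P.inv (P.inv p)), mul_inv p, one_mul]

theorem mul_right_cancel {x₁ x₂ x₃ : P.X} {h₁₂ : P.π x₁ = P.π x₂} {h₂₃ : P.π x₂ = P.π x₃}
    {p p' : P.Fib h₂₃} {q : P.Fib h₁₂} (h : P.mul p q = P.mul p' q) : p = p' := by
  rw [← mul_one p, ← mul_one p', ← mul_inv q, ← mul_assoc, ← mul_assoc, h]

/-- An idempotent of a groupoid is an identity. This pins down $e$ without reference to its choice.
-/
theorem eq_one_of_mul_self {x : P.X} {p : P.Fib (rfl : P.π x = P.π x)} (h : P.mul p p = p) :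
    p = P.one x :=
  mul_right_cancel (h.trans (one_mul p).symm)

theorem eq_inv_of_mul_eq_one {x₁ x₂ : P.X} {h : P.π x₁ = P.π x₂} {p : P.Fib h}
    {q : P.Fib h.symm} (hq : P.mul p q = P.one x₂) : q = P.inv p := by
  rw [← one_mul q, ← inv_mul p, mul_assoc, hq, mul_one]

namespace Mor

variable (f : Mor P Q)

theorem hat_smul {x₁ x₂ : P.X} {h : P.π x₁ = P.π x₂} (z : ℂˣ) (p : P.Fib h) :
    f.hat (z • p) = z • f.hat p :=
  f.total.equivariant _ z p

theorem hat_mul {x₁ x₂ x₃ : P.X} {h₁₂ : P.π x₁ = P.π x₂} {h₂₃ : P.π x₂ = P.π x₃}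
    (p : P.Fib h₂₃) (q : P.Fib h₁₂) : f.hat (P.mul p q) = Q.mul (f.hat p) (f.hat q) :=
  f.map_mul _ _ _ _

theorem hat_one (x : P.X) : f.hat (P.one x) = Q.one (f.base x) :=
  eq_one_of_mul_self (by rw [← hat_mul, mul_one])

end Mor

end Algebra

/-- Outside $U$ the local section is replaced by arbitrary preimages, since chart sections of a
`CxBundle` must be defined at every point. -/
theorem hasSmoothSections (P : BundleGerbe.{u} EM M) : HasSmoothSections EM P.E P.π := by
  classical
  intro m
  obtain ⟨U, hU, hm, s, hs, hsU⟩ := P.local_sections m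
  choose c hc using P.surjective_π
  refine ⟨U, U.piecewise s c, hU, hm, fun m' => ?_, fun m' hm' => ?_⟩
  · by_cases h : m' ∈ U
    · rw [Set.piecewise_eq_of_mem _ _ _ h, hsU _ h]
    · rw [Set.piecewise_eq_of_notMem _ _ _ h, hc]
  · exact .of_contMDiffOn hU
      (hs.congr fun x hx => Set.piecewise_eq_of_mem _ _ _ hx) hm'

/-! ### Smoothness of products, identities and inverses -/

section Smooth

variable {E' : Type*} [NormedAddCommGroup E'] [NormedSpace ℝ E']
  {H' : Type*} [TopologicalSpace H'] {I' : ModelWithCorners ℝ E' H'}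
  {N' : Type*} [TopologicalSpace N'] [ChartedSpace H' N']
  {B' : Type*} [TopologicalSpace B'] {ι' : B' → N'}

/-- The section `u` of `P` along `(x₁, x₂) : B' → X^[2]` is smooth near `b`. -/
abbrev SmoothAt (P : BundleGerbe.{u} EM M) (I' : ModelWithCorners ℝ E' H') (ι' : B' → N')
    {x₁ x₂ : B' → P.X} {h : ∀ b, P.π (x₁ b) = P.π (x₂ b)} (u : ∀ b, P.Fib (h b)) (b : B') : Prop :=
  P.bundle.SecSmoothAt I' ι' (fun b => FibSq.mk (h b)) u b

variable {x x₁ x₂ x₃ : B' → P.X} {b : B'}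

theorem SmoothAt.fst {h : ∀ b, P.π (x₁ b) = P.π (x₂ b)} {u : ∀ b, P.Fib (h b)}
    (hu : P.SmoothAt I' ι' u b) : SmoothMapAt I' ι' 𝓘(ℝ, P.E) (id : P.X → P.X) x₁ b :=
  ((FibSq.π₂ P.π).smoothMapAt _).comp hu.map

theorem SmoothAt.snd {h : ∀ b, P.π (x₁ b) = P.π (x₂ b)} {u : ∀ b, P.Fib (h b)}
    (hu : P.SmoothAt I' ι' u b) : SmoothMapAt I' ι' 𝓘(ℝ, P.E) (id : P.X → P.X) x₂ b :=
  ((FibSq.π₁ P.π).smoothMapAt _).comp hu.map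

theorem SmoothAt.mul {h₁₂ : ∀ b, P.π (x₁ b) = P.π (x₂ b)} {h₂₃ : ∀ b, P.π (x₂ b) = P.π (x₃ b)}
    {u : ∀ b, P.Fib (h₂₃ b)} {v : ∀ b, P.Fib (h₁₂ b)} (hu : P.SmoothAt I' ι' u b)
    (hv : P.SmoothAt I' ι' v b) : P.SmoothAt I' ι' (fun b => P.mul (u b) (v b)) b := by
  have hk := FibCube.smoothMapAt_mk h₁₂ h₂₃ hv.fst hu.fst hu.snd
  have hu' := (CxBundle.secSmoothAt_pullback_iff (h := FibCube.π₁ P.π) hk).2 hu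
  have hv' := (CxBundle.secSmoothAt_pullback_iff (h := FibCube.π₃ P.π) hk).2 hv
  exact (CxBundle.secSmoothAt_pullback_iff hk).1 (P.prod.secSmoothAt (hu'.tmul hv'))

/-- If $t$ is a smooth section along the diagonal and $t\,t=g\,t$, then $g$ is smooth and $g^{-1}t$
is idempotent, hence equal to $e$. -/
theorem smoothAt_one (hx : SmoothMapAt I' ι' 𝓘(ℝ, P.E) (id : P.X → P.X) x b) :
    P.SmoothAt I' ι' (fun b => P.one (x b)) b := by
  obtain ⟨t, ht⟩ := P.bundle.exists_secSmoothAt (FibSq.smoothMapAt_mk (fun b => rfl) hx hx)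
  obtain ⟨g, hg⟩ := P.bundle.exists_smul_eq t fun b => P.mul (t b) (t b)
  refine ht.of_smul_eq (ht.ratio (SmoothAt.mul ht ht) hg).inv fun b => ?_
  refine (eq_one_of_mul_self ?_).symm
  rw [smul_mul, mul_smul]
  exact congrArg _ ((congrArg _ (hg b)).trans (inv_smul_smul _ _))

/-- For smooth $t$ along the reversed pair, $e=g\,(u\,t)$ with $g$ smooth, so $u^{-1}=g\,t$. -/
theorem SmoothAt.inv {h : ∀ b, P.π (x₁ b) = P.π (x₂ b)} {u : ∀ b, P.Fib (h b)}
    (hu : P.SmoothAt I' ι' u b) : P.SmoothAt I' ι' (fun b => P.inv (u b)) b := by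
  obtain ⟨t, ht⟩ := P.bundle.exists_secSmoothAt
    (FibSq.smoothMapAt_mk (fun b => (h b).symm) hu.snd hu.fst)
  obtain ⟨g, hg⟩ := P.bundle.exists_smul_eq (fun b => P.mul (u b) (t b)) fun b => P.one (x₂ b)
  refine ht.of_smul_eq ((SmoothAt.mul hu ht).ratio (smoothAt_one hu.snd) hg) fun b => ?_
  refine (eq_inv_of_mul_eq_one ?_).symm
  rw [mul_smul]
  exact (hg b).symm

theorem SmoothAt.hat (f : Mor P Q) {h : ∀ b, P.π (x₁ b) = P.π (x₂ b)} {u : ∀ b, P.Fib (h b)}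
    (hu : P.SmoothAt I' ι' u b) : Q.SmoothAt I' ι' (fun b => f.hat (u b)) b :=
  (CxBundle.secSmoothAt_pullback_iff hu.map).1 (f.total.secSmoothAt hu)

end Smooth

/-! ### The descent isomorphism $\phi_{f,g}$ -/

namespace Mor

/-- The map `v ↦ ĝ(u) (v f̂(u⁻¹))`, for some `u ∈ P_{(x₁, x₂)}`. -/
noncomputable def conj (f g : Mor P Q) {x₁ x₂ : P.X} (h : P.π x₁ = P.π x₂)
    (v : Q.Fib (f.pi_eq₂ g x₁)) : Q.Fib (f.pi_eq₂ g x₂) :=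
  Q.mul (g.hat (P.nonempty_fib h).some) (Q.mul v (f.hat (P.inv (P.nonempty_fib h).some)))

/-- Here the dependence on the chosen $u_0$ disappears: with $u=zu_0$, the scalar $z$ comes out of
$\hat f$ on the left and of $\hat g$ on the right. -/
theorem conj_mul_hat (f g : Mor P Q) {x₁ x₂ : P.X} {h : P.π x₁ = P.π x₂} (u : P.Fib h)
    (v : Q.Fib (f.pi_eq₂ g x₁)) : Q.mul (f.conj g h v) (f.hat u) = Q.mul (g.hat u) v := by
  obtain ⟨z, hz, -⟩ := P.bundle.torsor _ (P.nonempty_fib h).some u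
  obtain rfl : u = z • (P.nonempty_fib h).some := hz
  rw [hat_smul, hat_smul, mul_smul, smul_mul, conj, mul_assoc, mul_assoc, ← hat_mul, inv_mul,
    hat_one, mul_one]

theorem conj_eq_iff (f g : Mor P Q) {x₁ x₂ : P.X} {h : P.π x₁ = P.π x₂} (u : P.Fib h)
    (v : Q.Fib (f.pi_eq₂ g x₁)) (w : Q.Fib (f.pi_eq₂ g x₂)) :
    f.conj g h v = w ↔ Q.mul w (f.hat u) = Q.mul (g.hat u) v := by
  rw [← conj_mul_hat]
  exact ⟨fun h => by rw [h], fun h => (mul_right_cancel h).symm⟩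

theorem conj_eq (f g : Mor P Q) {x₁ x₂ : P.X} {h : P.π x₁ = P.π x₂} (u : P.Fib h)
    (v : Q.Fib (f.pi_eq₂ g x₁)) :
    f.conj g h v = Q.mul (g.hat u) (Q.mul v (f.hat (P.inv u))) := by
  rw [conj_eq_iff f g u, mul_assoc, mul_assoc, ← hat_mul, inv_mul, hat_one, mul_one]

theorem conj_smul (f g : Mor P Q) {x₁ x₂ : P.X} (h : P.π x₁ = P.π x₂) (z : ℂˣ)
    (v : Q.Fib (f.pi_eq₂ g x₁)) : f.conj g h (z • v) = z • f.conj g h v := by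
  rw [conj, smul_mul, mul_smul, conj]

/-- Two naturality squares, for $u_{12}$ and $u_{23}$, paste to the square for $u_{23}u_{12}$. -/
theorem conj_conj (f g : Mor P Q) {x₁ x₂ x₃ : P.X} (h₁₂ : P.π x₁ = P.π x₂)
    (h₂₃ : P.π x₂ = P.π x₃) (v : Q.Fib (f.pi_eq₂ g x₁)) :
    f.conj g h₂₃ (f.conj g h₁₂ v) = f.conj g (h₁₂.trans h₂₃) v := by
  obtain ⟨u₁₂⟩ := P.nonempty_fib h₁₂
  obtain ⟨u₂₃⟩ := P.nonempty_fib h₂₃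
  symm
  rw [conj_eq_iff f g (P.mul u₂₃ u₁₂), hat_mul, hat_mul, ← mul_assoc, conj_mul_hat, mul_assoc,
    conj_mul_hat, mul_assoc]

/-- Stacking the squares for $f\Rightarrow g$ and $g\Rightarrow k$ gives that for $f\Rightarrow k$.
This is what lets the product of $Q$ descend to $M$. -/
theorem conj_mul_conj (f g k : Mor P Q) {x₁ x₂ : P.X} (h : P.π x₁ = P.π x₂)
    (v : Q.Fib (g.pi_eq₂ k x₁)) (v' : Q.Fib (f.pi_eq₂ g x₁)) :
    Q.mul (g.conj k h v) (f.conj g h v') = f.conj k h (Q.mul v v') := by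
  obtain ⟨u⟩ := P.nonempty_fib h
  symm
  rw [conj_eq_iff f k u, mul_assoc, conj_mul_hat, ← mul_assoc, conj_mul_hat, mul_assoc]

/-- The descent isomorphism `φ_{f,g}` of `D̂_{f,g}`. -/
noncomputable def descentIso (f g : Mor P Q) : DescentIso P.π (Dhat f g) where
  φ := CxBundle.Hom.ofLocal (fun b => f.conj g b.2) (fun b => f.conj_smul g b.2) fun b => by
    obtain ⟨t, ht⟩ := ((Dhat f g).pullback (FibSq.π₂ P.π)).exists_secSmoothAt
      (SmoothMapAt.id (I := 𝓘(ℝ, P.E).prod 𝓘(ℝ, P.E)) (ι := FibSq.incl P.π) b)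
    obtain ⟨u, hu⟩ := P.bundle.exists_secSmoothAt
      (SmoothMapAt.id (I := 𝓘(ℝ, P.E).prod 𝓘(ℝ, P.E)) (ι := FibSq.incl P.π) b)
    refine ⟨t, ht, (CxBundle.secSmoothAt_pullback_iff (SmoothMapAt.id b)).2
      ((CxBundle.secSmoothAt_pullback_iff ((FibSq.π₁ P.π).smoothMapAt b)).2 ?_)⟩
    have ht' : Q.SmoothAt _ _ (h := fun b => f.pi_eq₂ g b.1.1) t b :=
      (CxBundle.secSmoothAt_pullback_iff ((FibSq.π₂ P.π).smoothMapAt b)).1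
        ((CxBundle.secSmoothAt_pullback_iff (SmoothMapAt.id b)).1 ht)
    have hu' : P.SmoothAt _ _ (h := fun b => b.2) u b := hu
    have := SmoothAt.mul (SmoothAt.hat g hu') (SmoothAt.mul ht' (SmoothAt.hat f (SmoothAt.inv hu')))
    exact this.of_smul_eq .one fun b' =>
      (f.conj_eq g (h := b'.2) (u b') (t b')).trans (one_smul ℂˣ _).symm
  cocycle h₁₂ h₂₃ v := conj_conj f g h₁₂ h₂₃ v

end Mor

end BundleGerbe

/-! ## The 2-category -/

namespace BundleGerbe

variable {EM : Type v} [NormedAddCommGroup EM] [NormedSpace ℝ EM]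
  {M : Type w} [TopologicalSpace M] [ChartedSpace EM M]

universe t

/-- Given 2-arrows `T f g` with lifts to natural families of elements of `Q_{(f x, g x)}`, with
compositions and identities of the expected form, they form a strict 2-category. -/
theorem isTwoCategory_of_lift
    {T : ∀ {P Q : BundleGerbe.{u} EM M}, Mor P Q → Mor P Q → Type t}
    (l : ∀ {P Q : BundleGerbe.{u} EM M} {f g : Mor P Q}, T f g →
      ∀ x, Q.Fib (f.pi_eq₂ g x))
    (l_ext : ∀ {P Q : BundleGerbe.{u} EM M} {f g : Mor P Q} {θ η : T f g},
      (∀ x, l θ x = l η x) → θ = η)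
    (l_nat : ∀ {P Q : BundleGerbe.{u} EM M} {f g : Mor P Q} (θ : T f g) {x₁ x₂ : P.X}
      {h : P.π x₁ = P.π x₂} (u : P.Fib h),
      Q.mul (l θ x₂) (f.hat u) = Q.mul (g.hat u) (l θ x₁))
    (id₂ : ∀ {P Q : BundleGerbe.{u} EM M} (f : Mor P Q), T f f)
    (vcomp : ∀ {P Q : BundleGerbe.{u} EM M} {f g h : Mor P Q}, T f g → T g h → T f h)
    (hcomp : ∀ {P Q R : BundleGerbe.{u} EM M} {f₁ f₂ : Mor P Q} {g₁ g₂ : Mor Q R},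
      T f₁ f₂ → T g₁ g₂ → T (g₁.comp f₁) (g₂.comp f₂))
    (l_id : ∀ {P Q : BundleGerbe.{u} EM M} (f : Mor P Q) (x : P.X),
      l (id₂ f) x = Q.one (f.base x))
    (l_vcomp : ∀ {P Q : BundleGerbe.{u} EM M} {f g h : Mor P Q} (θ : T f g) (η : T g h) (x : P.X),
      l (vcomp θ η) x = Q.mul (l η x) (l θ x))
    (l_hcomp : ∀ {P Q R : BundleGerbe.{u} EM M} {f₁ f₂ : Mor P Q} {g₁ g₂ : Mor Q R}
      (θ : T f₁ f₂) (η : T g₁ g₂) (x : P.X),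
      l (hcomp θ η) x = R.mul (g₂.hat (h := f₁.pi_eq₂ f₂ x) (l θ x))
        (h₁₂ := g₁.pi_eq₂ g₂ (f₁.base x)) (l η (f₁.base x))) :
    IsTwoCategory (Ob := BundleGerbe.{u} EM M) Mor Mor.id (fun g f => g.comp f) (fun f g => T f g)
      id₂ vcomp hcomp := by
  have id_vcomp : ∀ {P Q : BundleGerbe.{u} EM M} {f g : Mor P Q} (θ : T f g),
      vcomp (id₂ f) θ = θ := fun θ => l_ext fun x => by rw [l_vcomp, l_id, mul_one]
  have vcomp_id : ∀ {P Q : BundleGerbe.{u} EM M} {f g : Mor P Q} (θ : T f g),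
      vcomp θ (id₂ g) = θ := fun θ => l_ext fun x => by rw [l_vcomp, l_id, one_mul]
  have vcomp_assoc : ∀ {P Q : BundleGerbe.{u} EM M} {f g h k : Mor P Q} (θ : T f g) (η : T g h)
      (ζ : T h k), vcomp (vcomp θ η) ζ = vcomp θ (vcomp η ζ) := fun θ η ζ =>
    l_ext fun x => by simp only [l_vcomp, mul_assoc]
  have l_right : ∀ {P Q R : BundleGerbe.{u} EM M} {f₁ f₂ : Mor P Q} (θ : T f₁ f₂) (g : Mor Q R)
      (x : P.X), l (hcomp θ (id₂ g)) x = g.hat (h := f₁.pi_eq₂ f₂ x) (l θ x) := fun θ g x => by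
    rw [l_hcomp, l_id]; exact mul_one _
  have l_left : ∀ {P Q R : BundleGerbe.{u} EM M} (f : Mor P Q) {g₁ g₂ : Mor Q R} (θ : T g₁ g₂)
      (x : P.X), l (hcomp (id₂ f) θ) x = l θ (f.base x) := fun f g₁ g₂ θ x => by
    rw [l_hcomp, l_id, Mor.hat_one]; exact one_mul _
  have left_id : ∀ {P Q R : BundleGerbe.{u} EM M} (f : Mor P Q) (g : Mor Q R),
      hcomp (id₂ f) (id₂ g) = id₂ (g.comp f) := fun f g =>
    l_ext fun x => (l_left _ _ _).trans ((l_id _ _).trans (l_id (g.comp f) _).symm)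
  have left_vcomp : ∀ {P Q R : BundleGerbe.{u} EM M} (f : Mor P Q) {g h k : Mor Q R} (η : T g h)
      (θ : T h k), hcomp (id₂ f) (vcomp η θ) = vcomp (hcomp (id₂ f) η) (hcomp (id₂ f) θ) :=
    fun f _ _ _ η θ => l_ext fun x => by
      rw [l_left, l_vcomp, l_vcomp, l_left, l_left]; rfl
  have vcomp_right : ∀ {P Q R : BundleGerbe.{u} EM M} {f g h : Mor P Q} (η : T f g) (θ : T g h)
      (k : Mor Q R), hcomp (vcomp η θ) (id₂ k) = vcomp (hcomp η (id₂ k)) (hcomp θ (id₂ k)) :=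
    fun η θ k => l_ext fun x => by
      rw [l_right, l_vcomp, l_vcomp, l_right, l_right]; exact k.hat_mul _ _
  have id_left : ∀ {P Q : BundleGerbe.{u} EM M} {f g : Mor P Q} (η : T f g),
      hcomp (id₂ (Mor.id P)) η = η := fun η => l_ext fun x => l_left _ _ _
  have right_id : ∀ {P Q : BundleGerbe.{u} EM M} {f g : Mor P Q} (η : T f g),
      hcomp η (id₂ (Mor.id Q)) = η := fun η => l_ext fun x => l_right _ _ _
  have left_left : ∀ {P Q R S : BundleGerbe.{u} EM M} (f : Mor P Q) (g : Mor Q R) {h k : Mor R S}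
      (η : T h k), hcomp (id₂ (g.comp f)) η = hcomp (id₂ f) (hcomp (id₂ g) η) :=
    fun f g _ _ η => l_ext fun x =>
      (l_left _ _ _).trans ((l_left f (hcomp (id₂ g) η) x).trans (l_left _ _ _)).symm
  have right_right : ∀ {P Q R S : BundleGerbe.{u} EM M} {f f' : Mor P Q} (η : T f f')
      (g : Mor Q R) (h : Mor R S), hcomp η (id₂ (h.comp g)) = hcomp (hcomp η (id₂ g)) (id₂ h) :=
    fun η g h => l_ext fun x => (l_right _ _ _).trans
      ((l_right (hcomp η (id₂ g)) h x).trans (congrArg h.hat (l_right η g x))).symm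
  have left_right : ∀ {P Q R S : BundleGerbe.{u} EM M} (f : Mor P Q) {g g' : Mor Q R} (η : T g g')
      (h : Mor R S), hcomp (hcomp (id₂ f) η) (id₂ h) = hcomp (id₂ f) (hcomp η (id₂ h)) :=
    fun f _ _ η h => l_ext fun x => (l_right (hcomp (id₂ f) η) h x).trans
      ((congrArg h.hat (l_left f η x)).trans
        ((l_left f (hcomp η (id₂ h)) x).trans (l_right η h _)).symm)
  -- This is naturality of $\eta$ at the arrow $\hat\theta(x)\in Q_{(f(x),f'(x))}$.
  have exchange : ∀ {P Q R : BundleGerbe.{u} EM M} {f f' : Mor P Q} {g g' : Mor Q R} (θ : T f f')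
      (η : T g g'), vcomp (hcomp (id₂ f) η) (hcomp θ (id₂ g')) =
        vcomp (hcomp θ (id₂ g)) (hcomp (id₂ f') η) := fun {_ _ _ f f'} _ _ θ η => l_ext fun x => by
    rw [l_vcomp, l_vcomp, l_right, l_right, l_left, l_left]
    exact (l_nat η (h := f.pi_eq₂ f' x) (l θ x)).symm
  -- The lift of the horizontal composite applies $\eta$ first, whereas `IsTwoCategory` whiskers
  -- $\theta$ first; `exchange` reconciles the two orders.
  have hcomp_eq : ∀ {P Q R : BundleGerbe.{u} EM M} {f f' : Mor P Q} {g g' : Mor Q R} (θ : T f f')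
      (η : T g g'), hcomp θ η = vcomp (hcomp θ (id₂ g)) (hcomp (id₂ f') η) := fun θ η =>
    l_ext fun x => by
      rw [← exchange, l_vcomp, l_right, l_left, l_hcomp]; rfl
  let cat : ∀ P Q : BundleGerbe.{u} EM M, Category.{t} (Mor P Q) := fun P Q =>
    { Hom := T
      id := id₂
      comp := vcomp
      id_comp := id_vcomp
      comp_id := vcomp_id
      assoc := vcomp_assoc }
  have triangle : ∀ {P Q R : BundleGerbe.{u} EM M} (f : Mor P Q) (g : Mor Q R),
      vcomp (id₂ (g.comp f)) (hcomp (id₂ f) (id₂ g)) = hcomp (id₂ f) (id₂ g) :=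
    fun f g => id_vcomp _
  have pentagon : ∀ {P Q R S S' : BundleGerbe.{u} EM M} (f : Mor P Q) (g : Mor Q R) (h : Mor R S)
      (k : Mor S S'), vcomp (hcomp (id₂ (h.comp (g.comp f))) (id₂ k))
        (vcomp (id₂ (k.comp ((h.comp g).comp f))) (hcomp (f₁ := f) (f₂ := f)
          (g₁ := k.comp (h.comp g)) (g₂ := k.comp (h.comp g)) (id₂ f) (id₂ _))) =
      vcomp (id₂ (k.comp (h.comp (g.comp f)))) (id₂ ((k.comp h).comp (g.comp f))) :=
    fun f g h k => by
      rw [left_id, left_id]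
      exact congrArg (vcomp _) (id_vcomp _)
  -- The bicategory axioms surround a 2-arrow with associators or unitors. These are identities
  -- here, and this equation absorbs them.
  have unit_vcomp : ∀ {P Q : BundleGerbe.{u} EM M} {f g : Mor P Q} (θ : T f g),
      θ = vcomp (id₂ f) (vcomp θ (id₂ g)) := fun θ => by rw [vcomp_id, id_vcomp]
  let bicat : Bicategory (BundleGerbe.{u} EM M) :=
    { Hom := Mor
      id := Mor.id
      comp := fun f g => g.comp f
      homCategory := cat
      whiskerLeft := fun f _ _ η => hcomp (id₂ f) η
      whiskerRight := fun θ g => hcomp θ (id₂ g)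
      -- Both bracketings are definitionally the same morphism, so identity isomorphisms typecheck;
      -- likewise for the unitors.
      associator := fun f g h => Iso.refl (h.comp (g.comp f))
      leftUnitor := fun f => Iso.refl f
      rightUnitor := fun f => Iso.refl f
      whiskerLeft_id := left_id
      whiskerLeft_comp := left_vcomp
      id_whiskerLeft := fun η => (id_left η).trans (unit_vcomp η)
      comp_whiskerLeft := fun f g _ _ η => (left_left f g η).trans (unit_vcomp _)
      id_whiskerRight := left_id
      comp_whiskerRight := vcomp_right
      whiskerRight_id := fun η => (right_id η).trans (unit_vcomp η)
      whiskerRight_comp := fun η g h => (right_right η g h).trans (unit_vcomp _)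
      whisker_assoc := fun f _ _ η h => (left_right f η h).trans (unit_vcomp _)
      whisker_exchange := exchange
      pentagon := pentagon
      triangle := triangle }
  refine ⟨bicat, { id_comp := fun _ => rfl, comp_id := fun _ => rfl, assoc := fun _ _ _ => rfl },
    Equiv.refl _, Equiv.refl _, fun _ => rfl, fun _ _ => rfl, fun _ => rfl, fun _ _ => rfl, ?_⟩
  intro P Q R f₁ f₂ g₁ g₂ θ η
  exact (hcomp_eq θ η).trans (unit_vcomp _)

end BundleGerbe

/-! ## Transformations -/

theorem CxBundle.sigma_tmul {E : Type*} [NormedAddCommGroup E] [NormedSpace ℝ E]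
    {H : Type*} [TopologicalSpace H] {I : ModelWithCorners ℝ E H}
    {N : Type*} [TopologicalSpace N] [ChartedSpace H N] {B : Type*} [TopologicalSpace B] {ι : B → N}
    {L : CxBundle.{v} I ι} {K : CxBundle.{w} I ι} {b b' : B} {p : L.fiber b} {p' : L.fiber b'}
    {q : K.fiber b} {q' : K.fiber b'} (hp : (⟨b, p⟩ : Σ b, L.fiber b) = ⟨b', p'⟩)
    (hq : (⟨b, q⟩ : Σ b, K.fiber b) = ⟨b', q'⟩) :
    (⟨b, tmul p q⟩ : Σ b, TensorFiber L K b) = ⟨b', tmul p' q'⟩ := by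
  obtain rfl : b = b' := congrArg Sigma.fst hp
  rw [sigma_mk_injective hp, sigma_mk_injective hq]

namespace BundleGerbe

variable {EM : Type*} [NormedAddCommGroup EM] [NormedSpace ℝ EM]
  {M : Type*} [TopologicalSpace M] [ChartedSpace EM M]
  {P Q R : BundleGerbe.{u} EM M}

/-! ### Transformations as smooth natural families -/

namespace Mor

theorem secSmoothAt_Dhat_iff {f g : Mor P Q} {t : ∀ x, (Dhat f g).fiber x} {x : P.X} :
    (Dhat f g).SecSmoothAt 𝓘(ℝ, P.E) (_root_.id : P.X → P.X) (fun x => x) t x ↔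
      Q.SmoothAt 𝓘(ℝ, P.E) (_root_.id : P.X → P.X) (h := f.pi_eq₂ g) t x :=
  CxBundle.secSmoothAt_pullback_iff (SmoothMapAt.id x)

theorem smoothMapAt_base (f : Mor P Q) (x : P.X) :
    SmoothMapAt 𝓘(ℝ, P.E) (_root_.id : P.X → P.X) 𝓘(ℝ, Q.E) (_root_.id : Q.X → Q.X) f.base x :=
  .of_contMDiff f.contMDiff_base x

variable {f g h : Mor P Q} (D : Descended P.contMDiff_π (f.descentIso g))
  (D' : Descended P.contMDiff_π (g.descentIso h)) (D'' : Descended P.contMDiff_π (f.descentIso h))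

theorem smoothAt_lift (θ : D.bundle.GlobalSection) (x : P.X) :
    Q.SmoothAt 𝓘(ℝ, P.E) (_root_.id : P.X → P.X) (h := f.pi_eq₂ g) (D.lift θ) x :=
  secSmoothAt_Dhat_iff.1 (D.secSmoothAt_lift θ x)

/-- Invariance of the lift under $\phi_{f,g}$, rewritten by `conj_eq_iff` as naturality of
$\hat\theta$. -/
theorem lift_mul_hat (θ : D.bundle.GlobalSection) {x₁ x₂ : P.X} {h : P.π x₁ = P.π x₂}
    (u : P.Fib h) : Q.mul (D.lift θ x₂) (f.hat u) = Q.mul (g.hat u) (D.lift θ x₁) :=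
  (conj_eq_iff f g u _ _).1 (D.trans_lift θ h)

theorem exists_lift_eq (t : ∀ x, Q.Fib (f.pi_eq₂ g x))
    (ht : ∀ x, Q.SmoothAt 𝓘(ℝ, P.E) (_root_.id : P.X → P.X) t x)
    (hn : ∀ {x₁ x₂ : P.X} {h : P.π x₁ = P.π x₂} (u : P.Fib h),
      Q.mul (t x₂) (f.hat u) = Q.mul (g.hat u) (t x₁)) :
    ∃ θ : D.bundle.GlobalSection, ∀ x, D.lift θ x = t x :=
  D.exists_lift_eq P.hasSmoothSections t (fun x => secSmoothAt_Dhat_iff.2 (ht x))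
    fun {x₁ x₂} h => by
    obtain ⟨u⟩ := P.nonempty_fib h
    exact (conj_eq_iff f g u _ _).2 (hn u)

theorem exists_lift_eq_one (D : Descended P.contMDiff_π (f.descentIso f)) :
    ∃ θ : D.bundle.GlobalSection, ∀ x, D.lift θ x = Q.one (f.base x) :=
  exists_lift_eq D _ (fun x => smoothAt_one (f.smoothMapAt_base x))
    fun _ => (one_mul _).trans (mul_one _).symm

theorem exists_lift_eq_hcomp {f₁ f₂ : Mor P Q} {g₁ g₂ : Mor Q R}
    (D₁ : Descended P.contMDiff_π (f₁.descentIso f₂))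
    (D₂ : Descended Q.contMDiff_π (g₁.descentIso g₂))
    (D₃ : Descended P.contMDiff_π ((g₁.comp f₁).descentIso (g₂.comp f₂)))
    (θ : D₁.bundle.GlobalSection) (η : D₂.bundle.GlobalSection) :
    ∃ ζ : D₃.bundle.GlobalSection, ∀ x, D₃.lift ζ x =
      R.mul (g₂.hat (h := f₁.pi_eq₂ f₂ x) (D₁.lift θ x))
        (h₁₂ := g₁.pi_eq₂ g₂ (f₁.base x)) (D₂.lift η (f₁.base x)) := by
  refine exists_lift_eq D₃ _ (fun x => ?_) fun {x₁ x₂} h u => ?_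
  · refine SmoothAt.mul (SmoothAt.hat g₂ (smoothAt_lift D₁ θ x)) ?_
    exact CxBundle.SecSmoothAt.comp (smoothAt_lift D₂ η (f₁.base x)) (f₁.smoothMapAt_base x)
  -- Naturality of $\eta$ at $\hat f_1(u)$ is used first, then $\hat g_2$ applied to naturality of
  -- $\theta$ at $u$.
  · refine (mul_assoc _ _ _).trans ((congrArg (R.mul _) (lift_mul_hat D₂ η (f₁.hat u))).trans ?_)
    refine (mul_assoc _ _ _).symm.trans (Eq.trans ?_ (mul_assoc _ _ _))
    refine congrArg (fun t => R.mul t (D₂.lift η (f₁.base x₁))) ?_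
    exact (g₂.hat_mul _ _).symm.trans
      ((congrArg g₂.hat (lift_mul_hat D₁ θ u)).trans (g₂.hat_mul _ _))

theorem exists_tmul_ψ (x : P.X) (p : (D'.bundle.tensor D.bundle).fiber (P.π x)) :
    ∃ (v : Q.Fib (g.pi_eq₂ h x)) (u : Q.Fib (f.pi_eq₂ g x)),
      p = CxBundle.tmul (D'.ψ.toFun x v) (D.ψ.toFun x u) := by
  obtain ⟨p, q⟩ := p
  obtain ⟨v, rfl⟩ := D'.ψ.exists_preimage x p
  obtain ⟨u, rfl⟩ := D.ψ.exists_preimage x q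
  exact ⟨v, u, rfl⟩

theorem tmul_ψ_smul (x : P.X) (a b : ℂˣ) (v : Q.Fib (g.pi_eq₂ h x)) (u : Q.Fib (f.pi_eq₂ g x)) :
    (CxBundle.tmul (D'.ψ.toFun x (a • v)) (D.ψ.toFun x (b • u)) :
      CxBundle.TensorFiber D'.bundle D.bundle (P.π x)) =
      (b * a) • CxBundle.tmul (D'.ψ.toFun x v) (D.ψ.toFun x u) := by
  have h₁ : D'.ψ.toFun x (a • v) = a • D'.ψ.toFun x v := D'.ψ.equivariant x a v
  have h₂ : D.ψ.toFun x (b • u) = b • D.ψ.toFun x u := D.ψ.equivariant x b u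
  rw [h₁, h₂]
  exact (CxBundle.tmul_smul _ _ _).trans
    (SemigroupAction.mul_smul b a (CxBundle.tmul (D'.ψ.toFun x v) (D.ψ.toFun x u) :
      CxBundle.TensorFiber D'.bundle D.bundle (P.π x))).symm

/-- The morphism of bundles on `M` induced by the product of `Q`. -/
theorem exists_tensor_hom : ∃ c : CxBundle.Hom (D'.bundle.tensor D.bundle) D''.bundle,
    ∀ (x : P.X) (v : Q.Fib (g.pi_eq₂ h x)) (u : Q.Fib (f.pi_eq₂ g x)),
      c.toFun (P.π x) (CxBundle.tmul (D'.ψ.toFun x v) (D.ψ.toFun x u)) =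
        D''.ψ.toFun x (Q.mul v u) := by
  have ψ_smul : ∀ (x : P.X) (z : ℂˣ) (v : Q.Fib (f.pi_eq₂ h x)),
      D''.ψ.toFun x (z • v) = z • D''.ψ.toFun x v := fun x z v => D''.ψ.equivariant x z v
  choose V U hVU using exists_tmul_ψ D D'
  -- The decomposition of $p$ as $\psi(V)\otimes\psi(U)$ is arbitrary. Another one differs by
  -- scalars $a$, $b$, and only their product $ba=z$ affects $VU$; this gives both well-definedness
  -- and equivariance.
  have hψ : ∀ (x : P.X) (z : ℂˣ) (p : (D'.bundle.tensor D.bundle).fiber (P.π x))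
      (v : Q.Fib (g.pi_eq₂ h x)) (u : Q.Fib (f.pi_eq₂ g x)),
      p = z • (CxBundle.tmul (D'.ψ.toFun x v) (D.ψ.toFun x u) :
        CxBundle.TensorFiber D'.bundle D.bundle (P.π x)) →
      D''.ψ.toFun x (Q.mul (V x p) (U x p)) = z • D''.ψ.toFun x (Q.mul v u) := by
    intro x z p v u hp
    obtain ⟨a, ha, -⟩ := Q.bundle.torsor _ v (V x p)
    obtain ⟨b, hb, -⟩ := Q.bundle.torsor _ u (U x p)
    have h₁ := (hVU x p).symm.trans hp
    rw [ha, hb] at h₁ ⊢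
    have h₂ : b * a = z := (D'.bundle.tensor D.bundle).smul_left_cancel
      ((tmul_ψ_smul D D' x a b v u).symm.trans h₁)
    rw [mul_smul, smul_mul, smul_smul, h₂]
    exact ψ_smul x z _
  have hψ₁ : ∀ (x : P.X) (v : Q.Fib (g.pi_eq₂ h x)) (u : Q.Fib (f.pi_eq₂ g x)),
      D''.ψ.toFun x (Q.mul (V x (CxBundle.tmul (D'.ψ.toFun x v) (D.ψ.toFun x u)))
        (U x (CxBundle.tmul (D'.ψ.toFun x v) (D.ψ.toFun x u)))) = D''.ψ.toFun x (Q.mul v u) :=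
    fun x v u => (hψ x 1 _ v u (one_smul _ _).symm).trans (one_smul _ _)
  let F : CxBundle.Hom
      ((D'.bundle.tensor D.bundle).pullback (BaseMap.ofContMDiff P.π P.contMDiff_π))
      (D''.bundle.pullback (BaseMap.ofContMDiff P.π P.contMDiff_π)) :=
    CxBundle.Hom.ofLocal (fun x p => D''.ψ.toFun x (Q.mul (V x p) (U x p)))
      (fun x z p => hψ x z _ _ _ (congrArg (z • ·) (hVU x p))) fun x => by
        have hx := SmoothMapAt.id (I := 𝓘(ℝ, P.E)) (ι := (_root_.id : P.X → P.X)) x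
        obtain ⟨v, hv⟩ := (Dhat g h).exists_secSmoothAt hx
        obtain ⟨u, hu⟩ := (Dhat f g).exists_secSmoothAt hx
        have hvu := secSmoothAt_Dhat_iff.2
          (SmoothAt.mul (secSmoothAt_Dhat_iff.1 hv) (secSmoothAt_Dhat_iff.1 hu))
        refine ⟨fun x => CxBundle.tmul (D'.ψ.toFun x (v x)) (D.ψ.toFun x (u x)),
          (CxBundle.secSmoothAt_pullback_iff hx).2 ?_, ?_⟩
        · exact CxBundle.SecSmoothAt.tmul
            ((CxBundle.secSmoothAt_pullback_iff hx).1 (D'.ψ.secSmoothAt hv))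
            ((CxBundle.secSmoothAt_pullback_iff hx).1 (D.ψ.secSmoothAt hu))
        · exact (D''.ψ.secSmoothAt hvu).of_smul_eq .one fun x =>
            (hψ₁ x (v x) (u x)).trans (one_smul ℂˣ _).symm
  obtain ⟨c, hc⟩ := CxBundle.Hom.exists_descent P.contMDiff_π P.hasSmoothSections F
      fun {x₁ x₂} k₁ k₂ hk => by
    obtain ⟨v, u, rfl⟩ := exists_tmul_ψ D D' x₁ k₁
    have hx : P.π x₁ = P.π x₂ := congrArg Sigma.fst hk
    -- Over $x_2$ the same element of the tensor product is represented by $\phi(v)\otimes\phi(u)$,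
    -- and $\phi(v)\,\phi(u)=\phi(vu)$, so both points give the same value on $M$.
    have hk₂ := hk.symm.trans (CxBundle.sigma_tmul (L := D'.bundle) (K := D.bundle)
      (D'.compat hx v).symm (D.compat hx u).symm)
    obtain rfl := sigma_mk_injective hk₂
    have h₁ : F.toFun x₁ _ = _ := hψ₁ x₁ v u
    have h₂ : F.toFun x₂ _ = _ := hψ₁ x₂ (g.conj h hx v) (f.conj g hx u)
    rw [conj_mul_conj] at h₂
    refine (congrArg (Sigma.mk (β := D''.bundle.fiber) (P.π x₁)) h₁).trans (Eq.trans ?_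
      (congrArg (Sigma.mk (β := D''.bundle.fiber) (P.π x₂)) h₂).symm)
    exact (D''.compat hx (Q.mul v u)).symm
  exact ⟨c, fun x v u => (hc x _).trans (hψ₁ x v u)⟩

end Mor

end BundleGerbe

/-- The image `φ (t ⊗ s)` of global sections under a morphism `φ : L ⊗ K → J`. -/
def CxBundle.Hom.mapTensor {E : Type*} [NormedAddCommGroup E] [NormedSpace ℝ E]
    {H : Type*} [TopologicalSpace H] {I : ModelWithCorners ℝ E H}
    {N : Type*} [TopologicalSpace N] [ChartedSpace H N] {B : Type*} [TopologicalSpace B] {ι : B → N}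
    {L K J : CxBundle.{v} I ι} (φ : Hom (L.tensor K) J) (t : L.GlobalSection)
    (s : K.GlobalSection) : J.GlobalSection :=
  ⟨fun b => φ.toFun b (tmul (t.1 b) (s.1 b)), φ.smooth Set.univ _ isOpen_univ
    ((isSmoothOn_iff _ isOpen_univ).2 fun b hb =>
      .tmul ((isSmoothOn_iff _ isOpen_univ).1 t.2 b hb) ((isSmoothOn_iff _ isOpen_univ).1 s.2 b hb))⟩

/-! ### Assembly of the 2-category -/

theorem mainTheorem5 {EM : Type v} [NormedAddCommGroup EM] [NormedSpace ℝ EM] [CompleteSpace EM]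
    {M : Type w} [TopologicalSpace M] [T2Space M] [ChartedSpace EM M]
    [IsManifold 𝓘(ℝ, EM) ∞ M] :
    -- the descent isomorphisms `φ_{f,g}` of the bundles `D̂_{f,g}`
    ∃ Φ : ∀ {P Q : BundleGerbe.{u} EM M} (f g : BundleGerbe.Mor P Q),
        DescentIso P.π (BundleGerbe.Mor.Dhat f g),
      (∀ {P Q : BundleGerbe.{u} EM M} (f g : BundleGerbe.Mor P Q) {x₁ x₂ : P.X}
        (h : P.π x₁ = P.π x₂) (u : P.Fib h) (v : Q.Fib (f.pi_eq₂ g x₁)),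
        (Φ f g).φ.toFun (FibSq.mk h) v = Q.mul (g.hat u) (Q.mul v (f.hat (P.inv u)))) ∧
      -- `D̂_{f,g}` descends to `M`
      (∀ {P Q : BundleGerbe.{u} EM M} (f g : BundleGerbe.Mor P Q),
        Nonempty (Descended P.contMDiff_π (Φ f g))) ∧
      -- for every choice of the descended bundles `D_{f,g}`:
      ∀ D : ∀ {P Q : BundleGerbe.{u} EM M} (f g : BundleGerbe.Mor P Q),
          Descended P.contMDiff_π (Φ f g),
        ∃ (c : ∀ {P Q : BundleGerbe.{u} EM M} (f g h : BundleGerbe.Mor P Q),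
            CxBundle.Hom ((D g h).bundle.tensor (D f g).bundle) (D f h).bundle)
          (id₂ : ∀ {P Q : BundleGerbe.{u} EM M} (f : BundleGerbe.Mor P Q),
            (D f f).bundle.GlobalSection)
          (vcomp : ∀ {P Q : BundleGerbe.{u} EM M} {f g h : BundleGerbe.Mor P Q},
            (D f g).bundle.GlobalSection → (D g h).bundle.GlobalSection →
              (D f h).bundle.GlobalSection)
          (hcomp : ∀ {P Q R : BundleGerbe.{u} EM M} {f₁ f₂ : BundleGerbe.Mor P Q}
            {g₁ g₂ : BundleGerbe.Mor Q R},
            (D f₁ f₂).bundle.GlobalSection → (D g₁ g₂).bundle.GlobalSection →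
              (D (g₁.comp f₁) (g₂.comp f₂)).bundle.GlobalSection),
          -- the isomorphism `D_{g,h} ⊗ D_{f,g} → D_{f,h}` induced by the product of `Q`
          (∀ {P Q : BundleGerbe.{u} EM M} (f g h : BundleGerbe.Mor P Q) (x : P.X)
            (v : Q.Fib (g.pi_eq₂ h x)) (u : Q.Fib (f.pi_eq₂ g x)),
            (c f g h).toFun (P.π x) (CxBundle.tmul ((D g h).ψ.toFun x v) ((D f g).ψ.toFun x u)) =
              (D f h).ψ.toFun x (Q.mul v u)) ∧
          -- identity transformations
          (∀ {P Q : BundleGerbe.{u} EM M} (f : BundleGerbe.Mor P Q) (x : P.X),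
            (D f f).lift (id₂ f) x = Q.one (f.base x)) ∧
          -- vertical composition
          (∀ {P Q : BundleGerbe.{u} EM M} {f g h : BundleGerbe.Mor P Q}
            (θ : (D f g).bundle.GlobalSection) (η : (D g h).bundle.GlobalSection) (m : M),
            (vcomp θ η).1 m = (c f g h).toFun m (CxBundle.tmul (η.1 m) (θ.1 m))) ∧
          -- horizontal composition
          (∀ {P Q R : BundleGerbe.{u} EM M} {f₁ f₂ : BundleGerbe.Mor P Q}
            {g₁ g₂ : BundleGerbe.Mor Q R} (θ : (D f₁ f₂).bundle.GlobalSection)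
            (η : (D g₁ g₂).bundle.GlobalSection) (x : P.X),
            (D (g₁.comp f₁) (g₂.comp f₂)).lift (hcomp θ η) x =
              R.mul (g₂.hat (h := f₁.pi_eq₂ f₂ x) ((D f₁ f₂).lift θ x))
                (h₁₂ := g₁.pi_eq₂ g₂ (f₁.base x)) ((D g₁ g₂).lift η (f₁.base x))) ∧
          -- the interchange law
          (∀ {P Q R : BundleGerbe.{u} EM M} {f₁ f₂ f₃ : BundleGerbe.Mor P Q}
            {g₁ g₂ g₃ : BundleGerbe.Mor Q R}
            (θ : (D f₁ f₂).bundle.GlobalSection) (θ' : (D f₂ f₃).bundle.GlobalSection)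
            (η : (D g₁ g₂).bundle.GlobalSection) (η' : (D g₂ g₃).bundle.GlobalSection),
            hcomp (vcomp θ θ') (vcomp η η') = vcomp (hcomp θ η) (hcomp θ' η')) ∧
          -- the 2-category of bundle gerbes on `M`
          IsTwoCategory (Ob := BundleGerbe.{u} EM M) BundleGerbe.Mor BundleGerbe.Mor.id
            (fun g f => g.comp f) (fun f g => (D f g).bundle.GlobalSection) id₂ vcomp hcomp := by
  refine ⟨fun f g => f.descentIso g, fun f g _ _ _ u v => f.conj_eq g u v,
    fun {P _} f g => (f.descentIso g).nonempty_descended _ P.hasSmoothSections, fun D => ?_⟩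
  choose c hc using fun (P Q : BundleGerbe.{u} EM M) (f g h : BundleGerbe.Mor P Q) =>
    BundleGerbe.Mor.exists_tensor_hom (D f g) (D g h) (D f h)
  choose id₂ hid using fun (P Q : BundleGerbe.{u} EM M) (f : BundleGerbe.Mor P Q) =>
    BundleGerbe.Mor.exists_lift_eq_one (D f f)
  choose hcomp hhcomp using fun (P Q R : BundleGerbe.{u} EM M) (f₁ f₂ : BundleGerbe.Mor P Q)
    (g₁ g₂ : BundleGerbe.Mor Q R) (θ : (D f₁ f₂).bundle.GlobalSection)
    (η : (D g₁ g₂).bundle.GlobalSection) =>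
    BundleGerbe.Mor.exists_lift_eq_hcomp (D f₁ f₂) (D g₁ g₂) (D (g₁.comp f₁) (g₂.comp f₂)) θ η
  have hvcomp : ∀ {P Q : BundleGerbe.{u} EM M} {f g h : BundleGerbe.Mor P Q}
      (θ : (D f g).bundle.GlobalSection) (η : (D g h).bundle.GlobalSection) (x : P.X),
      (D f h).lift ((c _ _ f g h).mapTensor η θ) x =
        Q.mul ((D g h).lift η x) ((D f g).lift θ x) := fun {P Q f g h} θ η x =>
    ((D f h).lift_eq_iff _ _ _).2 (Eq.trans (congrArg ((c _ _ f g h).toFun (P.π x))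
      (congrArg₂ CxBundle.tmul ((D g h).ψ_lift η x).symm ((D f g).ψ_lift θ x).symm))
      (hc _ _ f g h x _ _))
  have hext : ∀ {P Q : BundleGerbe.{u} EM M} {f g : BundleGerbe.Mor P Q}
      {θ η : (D f g).bundle.GlobalSection}, (∀ x, (D f g).lift θ x = (D f g).lift η x) → θ = η :=
    fun {P _ f g} => (D f g).ext_lift P.surjective_π
  refine ⟨fun f g h => c _ _ f g h, fun f => id₂ _ _ f, fun θ η => (c _ _ _ _ _).mapTensor η θ,
    fun θ η => hcomp _ _ _ _ _ _ _ θ η, fun f g h => hc _ _ f g h, fun f => hid _ _ f,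
    fun _ _ _ => rfl, fun θ η => hhcomp _ _ _ _ _ _ _ θ η, ?_, ?_⟩
  · intro P Q R f₁ f₂ f₃ g₁ g₂ g₃ θ θ' η η'
    refine hext fun x => ?_
    rw [hvcomp, hhcomp, hhcomp, hhcomp, hvcomp, hvcomp]
    -- After expanding $\hat g_3(\hat\theta'\hat\theta)$, the outer factors agree. What remains is
    -- $\hat g_3(\hat\theta)\,\hat\eta'(f_1x)=\hat\eta'(f_2x)\,\hat g_2(\hat\theta)$, naturality of
    -- $\eta'$ at $\hat\theta(x)$.
    refine (congrArg (fun t => R.mul t _) (g₃.hat_mul _ _)).trans ?_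
    refine (BundleGerbe.mul_assoc _ _ _).trans (Eq.trans ?_ (BundleGerbe.mul_assoc _ _ _).symm)
    refine congrArg (R.mul _) ?_
    refine (BundleGerbe.mul_assoc _ _ _).symm.trans
      (Eq.trans ?_ (BundleGerbe.mul_assoc _ _ _))
    exact congrArg (fun t => R.mul t _)
      (BundleGerbe.Mor.lift_mul_hat (D g₂ g₃) η' (h := f₁.pi_eq₂ f₂ x) ((D f₁ f₂).lift θ x)).symm
  · exact BundleGerbe.isTwoCategory_of_lift (T := fun f g => (D f g).bundle.GlobalSection)
      (fun {_ _ f g} θ => (D f g).lift θ) hext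
      (fun {_ _ f g} θ _ _ _ u => BundleGerbe.Mor.lift_mul_hat (D f g) θ u) _ _ _
      (fun f => hid _ _ f) hvcomp (fun θ η => hhcomp _ _ _ _ _ _ _ θ η)
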